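/- **Theorem (Explicit Noether normalization for affine varieties).** *Conventions.* Let $\mathbb{F}$ be a field with algebraic closure $\overline{\mathbb{F}}$. An affine variety $V\subseteq\mathbb{A}^n_{\mathbb{F}}$ over $\mathbb{F}$ is the set of common zeros in $\overline{\mathbb{F}}^n$ of a set of polynomials in $\mathbb{F}[X_1,\dots,X_n]$ (so $V$ may be reducible or empty); $I(V)\subseteq\mathbb{F}[X_1,\dots,X_n]$ is the ideal of polynomials vanishing on $V$, and $\mathbb{F}[V]=\mathbb{F}[X_1,\dots,X_n]/I(V)$. The dimension of $V$ is the largest length $r$ of a chain $V_0\subsetneq\cdots\subsetneq V_r$ of irreducible affine subvarieties of $V$ over $\mathbb{F}$. The degree of $V$ is the sum of the degrees of the irreducible components of $V$ over $\overline{\mathbb{F}}$, where the degree of an irreducible variety $W$ over $\overline{\mathbb{F}}$ is the number of points in which $W$ meets an affine subspace of codimension $\dim W$ in general position. Polynomials $f_1,\dots,f_m\in\mathbb{F}[X_1,\dots,X_n]$ define a finite morphism $V\to\mathbb{A}^m_{\mathbb{F}}$ if $\mathbb{F}[V]$ is a finitely generated module over the image of $\mathbb{F}[Y_1,\dots,Y_m]\to\mathbb{F}[V]$,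 $Y_i\mapsto f_i+I(V)$. *The map.* Let $n,d\ge 1$ and $m,k\in\{1,\dots,n\}$. Let $d_1,\dots,d_n$ be pairwise coprime integers greater than $d$, and let $M=(c_{i,j})\in\mathbb{F}^{m\times n}$ be $k$-regular, i.e. any $k$ distinct columns of $M$ are linearly independent. Let $\varphi=\varphi_{M}:\mathbb{A}^n_{\mathbb{F}}\to\mathbb{A}^m_{\mathbb{F}}$ be the polynomial map defined by $f_i=\sum_{j=1}^n c_{i,j}X_j^{d_j}$, $1\le i\le m$. 1. For every affine variety $V\subseteq\mathbb{A}^n_{\mathbb{F}}$ over $\mathbb{F}$ of dimension at most $k$ and degree at most $d$, the restriction $\varphi|_V:V\to\mathbb{A}^m_{\mathbb{F}}$ is a finite morphism. 2. Consequently there is a universal Noether normalization map of polynomial degree: there is an absolute constant $C>0$ such that for all $n,d\ge 1$ there are pairwise coprime integers $d_1,\dots,d_n>d$ with the following property. For every field $\mathbb{F}$, every $k\in\{1,\dots,n\}$ and all distinct $\omega_1,\dots,\omega_n\in\mathbb{F}$, the Vandermonde matrix $M=(\omega_j^{\,i-1})_{1\le i\le k,\,1\le j\le n}$ is $k$-regular,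 the polynomials $f_1,\dots,f_k$ defining $\varphi_M:\mathbb{A}^n_{\mathbb{F}}\to\mathbb{A}^k_{\mathbb{F}}$ have degree at most $C\,(n+d)\log(n+d)$, and $\varphi_M|_V:V\to\mathbb{A}^k_{\mathbb{F}}$ is a finite morphism for every affine variety $V\subseteq\mathbb{A}^n_{\mathbb{F}}$ over $\mathbb{F}$ of dimension at most $k$ and degree at most $d$. -/

import Mathlib

/-! Affine varieties over a field `F`, following the elementary convention: the affine space
`𝔸ⁿ` over `F` is the set `Kⁿ`, where `K` is an algebraic closure of `F`, and its closed subsets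
are the zero sets of polynomials with coefficients in `F`. The same definitions with `F = K` give
the varieties over the algebraically closed field. -/

namespace ExplicitNoether

noncomputable section

variable (F : Type*) {K : Type*} [Field F] [Field K] [Algebra F K] {n m : ℕ}

/-- `V ⊆ Kⁿ` is an affine variety over `F`: the set of common zeros of a set of polynomials with
coefficients in `F`. -/
def IsAffineVariety (V : Set (Fin n → K)) : Prop :=
  ∃ S : Set (MvPolynomial (Fin n) F), V = {x | ∀ p ∈ S, MvPolynomial.aeval x p = 0}

/-- An irreducible affine variety over `F`: nonempty, and not the union of two proper affine
subvarieties over `F`. -/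
def IsIrreducibleVariety (V : Set (Fin n → K)) : Prop :=
  IsAffineVariety F V ∧ V.Nonempty ∧
    ∀ W₁ W₂ : Set (Fin n → K), IsAffineVariety F W₁ → IsAffineVariety F W₂ →
      V = W₁ ∪ W₂ → W₁ = V ∨ W₂ = V

/-- `W` is an irreducible component over `F` of `V`: a maximal irreducible subvariety. -/
def IsIrreducibleComponent (V W : Set (Fin n → K)) : Prop :=
  Maximal (fun W : Set (Fin n → K) => IsIrreducibleVariety F W ∧ W ⊆ V) W

/-- The dimension over `F` of an affine variety `V`: the supremum of the lengths `r` of chains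
`V₀ ⊊ V₁ ⊊ ⋯ ⊊ V_r` of irreducible subvarieties of `V` (`⊥` for the empty variety). -/
def affineDim (V : Set (Fin n → K)) : WithBot ℕ∞ :=
  Order.krullDim {W : Set (Fin n → K) // IsIrreducibleVariety F W ∧ W ⊆ V}

/-- For `V ⊆ Kⁿ` (`K` algebraically closed) and `D : ℕ∞`: an affine subspace of codimension `r` in
general position meets `V` in exactly `D` points. The affine subspaces of codimension `r` are the
solution sets of the linear systems `A x = b` with `A` an `r × n` matrix of rank `r`, and
general position means that the coefficients `(A, b)` lie in a nonempty principal Zariski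
open set `G ≠ 0`. -/
def GeneralSectionCount (V : Set (Fin n → K)) (r : ℕ) (D : ℕ∞) : Prop :=
  ∃ G : MvPolynomial ((Fin r × Fin n) ⊕ Fin r) K, G ≠ 0 ∧
    ∀ (A : Matrix (Fin r) (Fin n) K) (b : Fin r → K), A.rank = r →
      MvPolynomial.eval (Sum.elim (fun ij => A ij.1 ij.2) b) G ≠ 0 →
        (V ∩ {x | A.mulVec x = b}).encard = D

/-- The degree of an irreducible affine variety `V` over the algebraically closed field `K`: the
number of points of intersection with an affine subspace of codimension `dim V` in general
position. (There is exactly one such `D`, so the infimum just picks it.) -/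
def irreducibleDegree (V : Set (Fin n → K)) : ℕ∞ :=
  sInf {D : ℕ∞ | ∃ r : ℕ, affineDim K V = (r : WithBot ℕ∞) ∧ GeneralSectionCount V r D}

/-- The degree of an affine variety `V ⊆ Kⁿ` (`K` algebraically closed): the sum of the degrees of
its irreducible components over `K`. (There are finitely many components, so the supremum of
the partial sums is their sum.) For a variety over a subfield `F` of which `K` is the algebraic
closure, this is by definition also its degree. -/
def affineDegree (V : Set (Fin n → K)) : ℕ∞ :=
  ⨆ s : Finset {W : Set (Fin n → K) // IsIrreducibleComponent K V W},
    ∑ W ∈ s, irreducibleDegree W.1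

/-- The coordinate ring `F[V] = F[X₁, …, Xₙ] / I(V)`. -/
abbrev CoordinateRing (V : Set (Fin n → K)) : Type _ :=
  MvPolynomial (Fin n) F ⧸ MvPolynomial.vanishingIdeal F V

variable {F}

/-- The map `Kⁿ → Kᵐ`, `a ↦ (f₁(a), …, f_m(a))`, defined by polynomials over `F`. -/
def polyMap (K : Type*) [Field K] [Algebra F K] (f : Fin m → MvPolynomial (Fin n) F) :
    (Fin n → K) → (Fin m → K) :=
  fun a i => MvPolynomial.aeval a (f i)

theorem aeval_polyMap (f : Fin m → MvPolynomial (Fin n) F) (a : Fin n → K)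
    (p : MvPolynomial (Fin m) F) :
    MvPolynomial.aeval (polyMap K f a) p = MvPolynomial.aeval a (MvPolynomial.aeval f p) :=
  (MvPolynomial.comp_aeval_apply f (MvPolynomial.aeval a) p).symm

theorem vanishingIdeal_le_comap (f : Fin m → MvPolynomial (Fin n) F)
    {V : Set (Fin n → K)} {V' : Set (Fin m → K)} (h : Set.MapsTo (polyMap K f) V V') :
    MvPolynomial.vanishingIdeal F V' ≤
      (MvPolynomial.vanishingIdeal F V).comap (MvPolynomial.aeval f) := by
  intro p hp a ha
  rw [← aeval_polyMap]
  exact hp _ (h ha)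

/-- The homomorphism `φ^♯ : F[V'] → F[V]`, `Y_i + I(V') ↦ f_i + I(V)`, associated with the morphism
`φ : V → V'` defined by `f₁, …, f_m`. -/
def comorphism (f : Fin m → MvPolynomial (Fin n) F)
    {V : Set (Fin n → K)} {V' : Set (Fin m → K)} (h : Set.MapsTo (polyMap K f) V V') :
    CoordinateRing F V' →ₐ[F] CoordinateRing F V :=
  Ideal.quotientMapₐ (MvPolynomial.vanishingIdeal F V) (MvPolynomial.aeval f)
    (vanishingIdeal_le_comap f h)

/-- The morphism `V → V'` defined by `f₁, …, f_m` is finite: `F[V]` is a finitely generated module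
over its subring `φ^♯(F[V'])`. -/
def IsFiniteMorphism (f : Fin m → MvPolynomial (Fin n) F)
    {V : Set (Fin n → K)} {V' : Set (Fin m → K)} (h : Set.MapsTo (polyMap K f) V V') : Prop :=
  Module.Finite (comorphism f h).range (CoordinateRing F V)

/-- The restriction to `V` of the polynomial map `𝔸ⁿ → 𝔸ᵐ` defined by `f₁, …, f_m` is a finite
morphism `V → 𝔸ᵐ`. -/
def RestrictsToFinite (f : Fin m → MvPolynomial (Fin n) F) (V : Set (Fin n → K)) : Prop :=
  IsFiniteMorphism f (V := V) (V' := Set.univ) (Set.mapsTo_univ (polyMap K f) V)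

/-- A matrix is `k`-regular if any `k` distinct columns are linearly independent. -/
def IsRegularMatrix (k : ℕ) (M : Matrix (Fin m) (Fin n) F) : Prop :=
  ∀ J : Finset (Fin n), J.card = k →
    LinearIndependent F (fun j : J => fun i : Fin m => M i j)

/-- The `k × n` Vandermonde matrix with entries `ω_j ^ (i - 1)`, `1 ≤ i ≤ k`, `1 ≤ j ≤ n`. -/
def vandermondeMatrix (k : ℕ) (ω : Fin n → F) : Matrix (Fin k) (Fin n) F :=
  fun i j => ω j ^ (i : ℕ)

/-- The polynomials `f_i = ∑_j c_{i,j} X_j ^ {d_j}`. -/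
def dklPoly (M : Matrix (Fin m) (Fin n) F) (e : Fin n → ℕ) (i : Fin m) :
    MvPolynomial (Fin n) F :=
  ∑ j, MvPolynomial.C (M i j) * MvPolynomial.X j ^ e j

end

end ExplicitNoether

namespace ExplicitNoether

open MvPolynomial

/-! ### Krull dimension and transcendence degree -/

section Dimension

/-! Write `K` for the algebraic closure and `e j` for the exponents. Two facts carry the finiteness.

(a) Any k + 1 coordinates satisfy on V a nonzero equation over `K` of degree at most d
(`exists_vanishing`). For an irreducible W of dimension r and degree δ, take r + 1 generic linear
forms and an irreducible relation P between them. After a generic shear, P has degree deg P in the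
first form and is separable in it. Over a generic value b of the other r forms it has deg P distinct
roots, each of which lifts to a point of the linear section of W at b; that section has δ points, so
deg P ≤ δ (`satisfyRelation_of_evalSystem_ne_zero`). Having a relation of bounded degree is the
vanishing of determinants, hence passes from generic forms to coordinates
(`satisfyRelation_of_generic`). For reducible V, multiply the equations of the components.

(b) By the valuative criterion (`isIntegral_of_forall_valuationSubring`) it suffices that a
valuation ring containing the constants and all f_i contains every x_j
(`mem_valuationSubring_of_relations`). If not, let γ > 1 be the maximum of v(x_j)^(e j), attained
exactly on S. If |S| ≤ k, regularity yields a combination of the f_i in which a single term has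
value γ and all others less, so it is not in the ring. If |S| > k, apply (a) to k + 1 indices in S.
All exponents are at most d < e j, and pairwise coprimality makes the values of distinct monomials
distinct; a unique dominant term cannot cancel. The coordinates are thus integral, and being
finitely many they generate a finite module.

For the universal map the exponents are consecutive primes, bounded by Chebyshev's estimate, and a
nonzero Vandermonde determinant gives regularity. -/

theorem ringKrullDim_le_of_isIntegral (R S : Type*) [CommRing R] [CommRing S] [Algebra R S]
    [Algebra.IsIntegral R S] : ringKrullDim S ≤ ringKrullDim R :=
  Order.krullDim_le_of_strictMono (PrimeSpectrum.comap (algebraMap R S)) fun _ _ h =>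
    Ideal.IsIntegral.comap_lt_comap h

/-- Incomparability bounds one side; for the other, lying over lifts the bottom of a chain of primes
and going up lifts the rest. -/
theorem ringKrullDim_eq_of_isIntegral (R S : Type*) [CommRing R] [CommRing S] [Algebra R S]
    [Algebra.IsIntegral R S] (hinj : Function.Injective (algebraMap R S)) :
    ringKrullDim S = ringKrullDim R := by
  refine le_antisymm (ringKrullDim_le_of_isIntegral R S) (iSup_le fun l => ?_)
  obtain ⟨P, -, hP, hPl⟩ := Ideal.exists_ideal_over_prime_of_isIntegral (S := S)
    (RelSeries.head l).asIdeal ⊥ (by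
      intro x hx
      have : x = 0 := hinj (by simpa using hx)
      simp [this])
  have : P.LiesOver (RelSeries.head l).asIdeal := ⟨hPl.symm⟩
  obtain ⟨L, hL, -⟩ := Ideal.exists_ltSeries_of_hasGoingUp l P
  rw [← hL]
  exact Order.LTSeries.length_le_krullDim L

/-- Noether normalization makes `R` integral over a polynomial ring in `s` variables, and both
invariants equal `s`. -/
theorem trdeg_eq_of_ringKrullDim_eq {k R : Type*} [Field k] [CommRing R] [IsDomain R]
    [Algebra k R] [Algebra.FiniteType k R] {r : ℕ} (h : ringKrullDim R = r) :
    Algebra.trdeg k R = r := by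
  obtain ⟨s, g, hg, hint⟩ := exists_integral_inj_algHom_of_fg k R
  algebraize [g.toRingHom]
  have hdim := ringKrullDim_eq_of_isIntegral (MvPolynomial (Fin s) k) R hg
  have hs : s = r := by
    rw [MvPolynomial.ringKrullDim_of_isNoetherianRing, ringKrullDim_eq_zero_of_field, h] at hdim
    simp only [Nat.card_eq_fintype_card, Fintype.card_fin, zero_add] at hdim
    exact_mod_cast hdim.symm
  subst hs
  have hscalar : IsScalarTower k (MvPolynomial (Fin s) k) R :=
    IsScalarTower.of_algebraMap_eq fun x => (g.commutes x).symm
  have hfaith : FaithfulSMul (MvPolynomial (Fin s) k) R :=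
    (faithfulSMul_iff_algebraMap_injective _ _).mpr hg
  have h1 := lift_trdeg_add_eq k (MvPolynomial (Fin s) k) R
  rw [trdeg_eq_zero (R := MvPolynomial (Fin s) k) (A := R)] at h1
  rw [MvPolynomial.trdeg_of_isDomain] at h1
  simp at h1
  exact h1.symm

end Dimension

/-! ### Varieties, prime ideals, and the change of field from `F` to `K` -/

section Varieties

variable {F K : Type*} [Field F] [Field K] [Algebra F K] {n : ℕ}

theorem isAffineVariety_zeroLocus (I : Ideal (MvPolynomial (Fin n) F)) :
    IsAffineVariety F (zeroLocus K I) :=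
  ⟨I, rfl⟩

theorem isAffineVariety_iff {V : Set (Fin n → K)} :
    IsAffineVariety F V ↔ zeroLocus K (vanishingIdeal F V) = V := by
  constructor
  · rintro ⟨S, rfl⟩
    rw [← zeroLocus_span]
    exact zeroLocus_vanishingIdeal_galoisConnection.l_u_l_eq_l _
  · intro h
    exact h ▸ isAffineVariety_zeroLocus _

theorem IsAffineVariety.baseChange {V : Set (Fin n → K)} (hV : IsAffineVariety F V) :
    IsAffineVariety K V := by
  obtain ⟨S, rfl⟩ := hV
  refine ⟨Set.image (MvPolynomial.map (algebraMap F K)) S, ?_⟩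
  ext x
  simp [aeval_def]

theorem IsIrreducibleVariety.isPrime {V : Set (Fin n → K)} (hV : IsIrreducibleVariety F V) :
    (vanishingIdeal F V).IsPrime := by
  obtain ⟨hVa, ⟨x₀, hx₀⟩, hirr⟩ := hV
  refine ⟨fun h => ?_, fun {p q} hpq => ?_⟩
  · have h1 : (1 : MvPolynomial (Fin n) F) ∈ vanishingIdeal F V := h ▸ Submodule.mem_top
    simpa using h1 x₀ hx₀
  · have key : ∀ p : MvPolynomial (Fin n) F, IsAffineVariety F (V ∩ {x | aeval x p = 0}) := by
      obtain ⟨S, rfl⟩ := hVa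
      intro p
      refine ⟨insert p S, ?_⟩
      ext x
      simp [and_comm]
    rcases hirr _ _ (key p) (key q) (by
      ext x
      constructor
      · intro hx
        have := hpq x hx
        rw [map_mul, mul_eq_zero] at this
        exact this.imp (fun h => ⟨hx, h⟩) (fun h => ⟨hx, h⟩)
      · rintro (h | h) <;> exact h.1) with h | h
    · exact Or.inl fun x hx => (h.symm ▸ hx : x ∈ V ∩ {x | aeval x p = 0}).2
    · exact Or.inr fun x hx => (h.symm ▸ hx : x ∈ V ∩ {x | aeval x q = 0}).2

theorem isIrreducibleVariety_zeroLocus [IsAlgClosed K] (P : Ideal (MvPolynomial (Fin n) F))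
    [hP : P.IsPrime] : IsIrreducibleVariety F (zeroLocus K P) := by
  have hvan : vanishingIdeal F (zeroLocus K P) = P := IsPrime.vanishingIdeal_zeroLocus P
  refine ⟨isAffineVariety_zeroLocus P, ?_, fun W₁ W₂ h₁ h₂ h => ?_⟩
  · by_contra hne
    rw [Set.not_nonempty_iff_eq_empty] at hne
    rw [hne, vanishingIdeal_empty] at hvan
    exact hP.ne_top hvan.symm
  · have hle : vanishingIdeal F W₁ * vanishingIdeal F W₂ ≤ P := by
      rw [Ideal.mul_le]
      intro p hp q hq
      rw [← hvan]
      intro x hx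
      rw [map_mul]
      rcases (h ▸ hx : x ∈ W₁ ∪ W₂) with hx | hx
      · rw [hp x hx, zero_mul]
      · rw [hq x hx, mul_zero]
    rw [isAffineVariety_iff] at h₁ h₂
    rcases hP.mul_le.mp hle with hPle | hPle
    · left
      refine Set.Subset.antisymm (h ▸ Set.subset_union_left) ?_
      rw [← h₁]
      exact zeroLocus_anti_mono hPle
    · right
      refine Set.Subset.antisymm (h ▸ Set.subset_union_right) ?_
      rw [← h₂]
      exact zeroLocus_anti_mono hPle

/-- Irreducible subvarieties of `V` correspond to the primes containing `I(V)`. -/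
noncomputable def irreducibleSubvarietyOrderIso [IsAlgClosed K] {V : Set (Fin n → K)}
    (hV : IsAffineVariety F V) :
    {W : Set (Fin n → K) // IsIrreducibleVariety F W ∧ W ⊆ V} ≃o
      (PrimeSpectrum.zeroLocus (vanishingIdeal F V : Set (MvPolynomial (Fin n) F)))ᵒᵈ where
  toFun W := OrderDual.toDual
    ⟨⟨vanishingIdeal F W.1, W.2.1.isPrime⟩, vanishingIdeal_anti_mono W.2.2⟩
  invFun P := ⟨zeroLocus K (OrderDual.ofDual P).1.asIdeal, isIrreducibleVariety_zeroLocus _, by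
    conv_rhs => rw [← isAffineVariety_iff.mp hV]
    exact zeroLocus_anti_mono (OrderDual.ofDual P).2⟩
  left_inv W := Subtype.ext (isAffineVariety_iff.mp W.2.1.1)
  right_inv P := by
    apply OrderDual.ofDual.injective
    apply Subtype.ext
    apply PrimeSpectrum.ext
    exact IsPrime.vanishingIdeal_zeroLocus _
  map_rel_iff' {W W'} := by
    change vanishingIdeal F W'.1 ≤ vanishingIdeal F W.1 ↔ W.1 ⊆ W'.1
    refine ⟨fun h => ?_, fun h => vanishingIdeal_anti_mono h⟩
    rw [← isAffineVariety_iff.mp W.2.1.1, ← isAffineVariety_iff.mp W'.2.1.1]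
    exact zeroLocus_anti_mono h

theorem affineDim_eq_ringKrullDim [IsAlgClosed K] {V : Set (Fin n → K)}
    (hV : IsAffineVariety F V) : affineDim F V = ringKrullDim (CoordinateRing F V) := by
  rw [affineDim, Order.krullDim_eq_of_orderIso (irreducibleSubvarietyOrderIso hV),
    Order.krullDim_orderDual, ringKrullDim_quotient]

theorem isIntegral_map_mvPolynomial [Algebra.IsAlgebraic F K] (p : MvPolynomial (Fin n) K) :
    (MvPolynomial.map (σ := Fin n) (algebraMap F K)).IsIntegralElem p := by
  induction p using MvPolynomial.induction_on with
  | C a =>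
    obtain ⟨q, hq, hqa⟩ := (Algebra.IsIntegral.isIntegral (R := F) a)
    refine ⟨q.map C, hq.map _, ?_⟩
    have := congrArg (C (σ := Fin n)) hqa
    rw [Polynomial.hom_eval₂, map_zero] at this
    rw [Polynomial.eval₂_map, ← this]
    congr 1
    ext; simp
  | add p q hp hq => exact hp.add _ hq
  | mul_X p i hp =>
    refine hp.mul _ ?_
    have := RingHom.isIntegralElem_map (MvPolynomial.map (σ := Fin n) (algebraMap F K))
      (x := X i)
    simpa using this

/-- Passing from `F` to the algebraic closure does not increase the dimension. -/
theorem affineDim_le_affineDim [IsAlgClosed K] [Algebra.IsAlgebraic F K] {V W : Set (Fin n → K)}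
    (hV : IsAffineVariety F V) (hWV : W ⊆ V) : affineDim K W ≤ affineDim F V := by
  let _ : Algebra (MvPolynomial (Fin n) F) (MvPolynomial (Fin n) K) :=
    (MvPolynomial.map (algebraMap F K)).toAlgebra
  have : Algebra.IsIntegral (MvPolynomial (Fin n) F) (MvPolynomial (Fin n) K) :=
    ⟨isIntegral_map_mvPolynomial⟩
  have hprime : ∀ U : {U : Set (Fin n → K) // IsIrreducibleVariety K U ∧ U ⊆ W},
      ((vanishingIdeal K U.1).comap (algebraMap (MvPolynomial (Fin n) F)
        (MvPolynomial (Fin n) K))).IsPrime := fun U =>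
    have := U.2.1.isPrime
    Ideal.IsPrime.comap _
  -- An irreducible variety over `K` goes to its Zariski closure over `F`. Strictness is
  -- incomparability of primes in the integral extension of polynomial rings.
  refine Order.krullDim_le_of_strictMono (fun U => ⟨zeroLocus K ((vanishingIdeal K U.1).comap
    (algebraMap (MvPolynomial (Fin n) F) (MvPolynomial (Fin n) K))), ?_, ?_⟩) ?_
  · have := hprime U
    exact isIrreducibleVariety_zeroLocus _
  · conv_rhs => rw [← isAffineVariety_iff.mp hV]
    refine zeroLocus_anti_mono fun p hp x hx => ?_
    have := hp x (hWV (U.2.2 hx))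
    change aeval x (MvPolynomial.map (algebraMap F K) p) = 0
    rwa [aeval_map_algebraMap]
  · intro U U' hlt
    have hp := hprime U
    have hp' := hprime U'
    have hq := U.2.1.isPrime
    have hq' := U'.2.1.isPrime
    have h1 : vanishingIdeal K U'.1 < vanishingIdeal K U.1 := by
      refine lt_of_le_of_ne (vanishingIdeal_anti_mono hlt.le) fun h => hlt.ne ?_
      apply Subtype.ext
      rw [← isAffineVariety_iff.mp U.2.1.1, ← isAffineVariety_iff.mp U'.2.1.1, h]
    have h2 := Ideal.IsIntegral.comap_lt_comap (R := MvPolynomial (Fin n) F) h1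
    refine lt_of_le_of_ne (zeroLocus_anti_mono h2.le) fun h => h2.ne ?_
    have h3 := congrArg (fun U => vanishingIdeal F U.1) h
    simp only [] at h3
    rw [IsPrime.vanishingIdeal_zeroLocus, IsPrime.vanishingIdeal_zeroLocus] at h3
    exact h3.symm

end Varieties

/-! ### Restriction to lines, separability, elimination -/

section Polynomials

theorem exists_eval_ne_zero {σ K : Type*} [Field K] [Infinite K] {p : MvPolynomial σ K}
    (hp : p ≠ 0) : ∃ x, eval x p ≠ 0 := by
  by_contra! h
  exact hp (MvPolynomial.funext fun x => by simpa using h x)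

theorem totalDegree_aeval_le_of_totalDegree_le_one {σ τ K : Type*} [Field K]
    (f : σ → MvPolynomial τ K) (hf : ∀ i, (f i).totalDegree ≤ 1) (p : MvPolynomial σ K) :
    (aeval f p).totalDegree ≤ p.totalDegree := by
  rw [aeval_def, eval₂_eq]
  refine totalDegree_finsetSum_le fun α hα => ?_
  refine (totalDegree_mul _ _).trans ?_
  rw [algebraMap_eq, totalDegree_C, zero_add]
  refine (totalDegree_finsetProd _ _).trans ?_
  refine le_trans (Finset.sum_le_sum fun i _ => ?_) (le_totalDegree hα)
  refine (totalDegree_pow _ _).trans ?_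
  simpa using Nat.mul_le_mul_left (α i) (hf i)

/-- Restriction of a polynomial to a line through the origin. -/
theorem coeff_aeval_C_mul_X {σ K : Type*} [Field K] (w : σ → K) (p : MvPolynomial σ K) (e : ℕ) :
    (aeval (fun i => Polynomial.C (w i) * Polynomial.X) p : Polynomial K).coeff e =
      eval w (homogeneousComponent e p) := by
  induction p using MvPolynomial.induction_on' with
  | monomial α a =>
    rw [aeval_monomial, homogeneousComponent_apply]
    simp only [mul_pow, Finsupp.prod_mul]
    have h1 : (α.prod fun _ k => (Polynomial.X : Polynomial K) ^ k) =
        Polynomial.X ^ α.degree := by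
      rw [Finsupp.prod, Finset.prod_pow_eq_pow_sum, Finsupp.degree_apply]
    have h2 : (α.prod fun i k => Polynomial.C (w i) ^ k) =
        Polynomial.C (α.prod fun i k => w i ^ k) := by
      simp [Finsupp.prod]
    rw [h1, h2, ← mul_assoc, Polynomial.algebraMap_eq, ← Polynomial.C_mul,
      Polynomial.coeff_C_mul_X_pow]
    classical
    by_cases ha : a = 0
    · simp [ha]
    · rw [support_monomial, if_neg ha, Finset.filter_singleton]
      by_cases he : e = α.degree
      · simp [he, eval_monomial]
      · rw [if_neg he, if_neg (Ne.symm he)]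
        simp
  | add p q hp hq => simp [hp, hq]

theorem derivative_aeval {σ K : Type*} [Fintype σ] [Field K] (f : σ → Polynomial K)
    (p : MvPolynomial σ K) :
    Polynomial.derivative (aeval f p) =
      ∑ i, aeval f (pderiv i p) * Polynomial.derivative (f i) := by
  classical
  induction p using MvPolynomial.induction_on with
  | C a => simp [Polynomial.algebraMap_eq]
  | add p q hp hq => simp [hp, hq, add_mul, Finset.sum_add_distrib]
  | mul_X p j hp =>
    simp only [map_mul, aeval_X, Polynomial.derivative_mul, hp, Derivation.leibniz, smul_eq_mul,
      map_add, add_mul, Finset.sum_add_distrib, pderiv_X]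
    rw [add_comm]
    congr 1
    · rw [Finset.sum_eq_single j]
      · simp
      · intro b _ hb
        simp [Pi.single_eq_of_ne' hb]
      · simp
    · rw [Finset.sum_mul]
      exact Finset.sum_congr rfl fun i _ => by ring

/-- Over a perfect field an irreducible polynomial has a nonzero partial derivative. -/
theorem exists_pderiv_ne_zero {σ K : Type*} [Field K] [PerfectField K] {P : MvPolynomial σ K}
    (hP : Irreducible P) : ∃ i, pderiv i P ≠ 0 := by
  classical
  by_contra! h
  have hcoeff : ∀ α ∈ P.support, ∀ i, (α i : K) = 0 := by
    intro α hα i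
    by_cases hαi : α i = 0
    · simp [hαi]
    have h1 : coeff (α - Finsupp.single i 1) (pderiv i P) = 0 := by rw [h i, coeff_zero]
    rw [coeff_pderiv] at h1
    have h2 : α - Finsupp.single i 1 + Finsupp.single i 1 = α :=
      tsub_add_cancel_of_le (by simpa [Nat.one_le_iff_ne_zero] using hαi)
    rw [h2] at h1
    have h3 := (mul_eq_zero.mp h1).resolve_left (mem_support_iff.mp hα)
    have h4 : (α - Finsupp.single i 1 : σ →₀ ℕ) i + 1 = α i := by
      simp; omega
    rw [← h4]
    push_cast
    exact_mod_cast h3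
  obtain ⟨p, hp⟩ := CharP.exists K
  rcases CharP.char_is_prime_or_zero K p with hpp | rfl
  · have := Fact.mk hpp
    have := PerfectField.toPerfectRing (K := K) p
    have hdvd : ∀ α ∈ P.support, ∃ β : σ →₀ ℕ, α = p • β := fun α hα =>
      ⟨α.mapRange (· / p) (Nat.zero_div p), by
        ext i
        have := (CharP.cast_eq_zero_iff K p _).mp (hcoeff α hα i)
        simp [Nat.mul_div_cancel' this]⟩
    choose! β hβ using hdvd
    -- All exponents are divisible by `p` and all coefficients are `p`-th powers, so `P` has the
    -- `p`-th root `Q`.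
    let Q : MvPolynomial σ K := ∑ α ∈ P.support, monomial (β α) ((frobeniusEquiv K p).symm
      (coeff α P))
    have hQ : Q ^ p = P := by
      rw [← map_frobenius_expand p]
      conv_rhs => rw [P.as_sum]
      simp only [Q, map_sum, expand_monomial, map_monomial]
      refine Finset.sum_congr rfl fun α hα => ?_
      rw [← hβ α hα]
      congr 1
      exact (frobeniusEquiv K p).apply_symm_apply _
    exact not_irreducible_pow hpp.ne_one (hQ.symm ▸ hP)
  · have := CharP.charP_to_charZero K
    have hC : P = C (coeff 0 P) := by
      ext α
      rw [coeff_C]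
      split_ifs with h0
      · rw [h0]
      · by_contra hne
        exact h0 (Finsupp.ext fun i => by
          have := hcoeff α (mem_support_iff.mpr hne) i
          exact (Nat.cast_eq_zero.mp this).symm)
    have hne : coeff 0 P ≠ 0 := by
      intro h0
      rw [h0, C_0] at hC
      exact hP.ne_zero hC
    exact hP.not_isUnit (hC ▸ (isUnit_iff_ne_zero.mpr hne).map C)

/-- Over a factorial ring `B`, an irreducible polynomial `p` of positive degree and a polynomial
not divisible by it generate an ideal containing a nonzero constant. -/
theorem exists_mul_add_mul_eq_C {B : Type*} [CommRing B] [IsDomain B]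
    [UniqueFactorizationMonoid B] {p q : Polynomial B} (hp : Irreducible p)
    (hdeg : p.natDegree ≠ 0) (hpq : ¬ p ∣ q) :
    ∃ (u w : Polynomial B) (c : B), c ≠ 0 ∧ u * p + w * q = Polynomial.C c := by
  have hprim : p.IsPrimitive := hp.isPrimitive hdeg
  let E := FractionRing B
  -- Gauss's lemma moves the problem to a polynomial ring over a field, where Bézout holds; clearing
  -- denominators produces `c`.
  have hpE : Irreducible (p.map (algebraMap B E)) :=
    hprim.irreducible_iff_irreducible_map_fraction_map.mp hp
  have hndvd : ¬ p.map (algebraMap B E) ∣ q.map (algebraMap B E) := fun h =>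
    hpq (hprim.dvd_of_fraction_map_dvd_fraction_map h)
  obtain ⟨u, w, huw⟩ := hpE.coprime_iff_not_dvd.mpr hndvd
  obtain ⟨b, hb0, hb⟩ := IsLocalization.integerNormalization_spec (nonZeroDivisors B) u
  obtain ⟨c, hc0, hc⟩ := IsLocalization.integerNormalization_spec (nonZeroDivisors B) w
  refine ⟨Polynomial.C c * IsLocalization.integerNormalization (nonZeroDivisors B) u,
    Polynomial.C b * IsLocalization.integerNormalization (nonZeroDivisors B) w,
    b * c, mul_ne_zero (nonZeroDivisors.ne_zero hb0) (nonZeroDivisors.ne_zero hc0), ?_⟩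
  apply Polynomial.map_injective (algebraMap B E) (IsFractionRing.injective B E)
  simp only [Polynomial.map_add, Polynomial.map_mul, Polynomial.map_C, hb, hc,
    Algebra.smul_def, Polynomial.algebraMap_apply, map_mul]
  linear_combination (Polynomial.C (algebraMap B E b) * Polynomial.C (algebraMap B E c)) * huw

end Polynomials

/-! ### Lying over at one prime -/

section LyingOver

/-- Lying over for a prime `𝔮` at which the algebra becomes integral. -/
theorem exists_prime_comap_eq_of_leadingCoeff_notMem {A R : Type*} [CommRing A] [CommRing R]
    [Algebra A R] (𝔮 : Ideal A) [h𝔮 : 𝔮.IsPrime] (hker : RingHom.ker (algebraMap A R) ≤ 𝔮)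
    (s : Set R) (hs : Algebra.adjoin A s = ⊤)
    (halg : ∀ x ∈ s, ∃ q : Polynomial A, q.leadingCoeff ∉ 𝔮 ∧ Polynomial.aeval x q = 0) :
    ∃ Q : Ideal R, Q.IsPrime ∧ Q.comap (algebraMap A R) = 𝔮 := by
  -- Localizing at the complement of `𝔮` makes the leading coefficients units, so the extension
  -- becomes integral and ordinary lying over applies. `hker` keeps the localized algebra nonzero.
  let M := 𝔮.primeCompl
  let A' := Localization.AtPrime 𝔮
  let R' := Localization (Algebra.algebraMapSubmonoid R M)
  let _ : Algebra A' R' := localizationAlgebra M R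
  have hcomp : (algebraMap A' R').comp (algebraMap A A') =
      (algebraMap R R').comp (algebraMap A R) := by
    rw [localizationAlgebraMap_def]
    exact IsLocalization.map_comp _
  have hcomp' : ∀ a, algebraMap A' R' (algebraMap A A' a) = algebraMap R R' (algebraMap A R a) :=
    fun a => RingHom.congr_fun hcomp a
  have hint : Algebra.IsIntegral A' R' := by
    have h1 : ∀ x : R, IsIntegral A' (algebraMap R R' x) := by
      intro x
      have hx : x ∈ Algebra.adjoin A s := hs ▸ Algebra.mem_top
      induction hx using Algebra.adjoin_induction with
      | mem x hx =>
        obtain ⟨q, hq, hqx⟩ := halg x hx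
        exact is_integral_localization_at_leadingCoeff (M := M) q hqx hq
      | algebraMap a =>
        rw [← hcomp']
        exact isIntegral_algebraMap
      | add x y _ _ hx hy => rw [map_add]; exact hx.add hy
      | mul x y _ _ hx hy => rw [map_mul]; exact hx.mul hy
    refine ⟨fun x => ?_⟩
    obtain ⟨⟨y, ⟨_, u, hu, rfl⟩⟩, hx⟩ := IsLocalization.surj (Algebra.algebraMapSubmonoid R M) x
    obtain ⟨v, hv⟩ := isUnit_iff_exists_inv'.mp (IsLocalization.map_units A' (⟨u, hu⟩ : M))
    have hxy : x = algebraMap A' R' v * algebraMap R R' y := by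
      rw [← hx]
      have := congrArg (algebraMap A' R') hv
      rw [map_mul, map_one, hcomp'] at this
      linear_combination (-x) * this
    rw [hxy]
    exact isIntegral_algebraMap.mul (h1 y)
  have hnontriv : Nontrivial R' := by
    by_contra h
    rw [not_nontrivial_iff_subsingleton,
      IsLocalization.subsingleton_iff (M := Algebra.algebraMapSubmonoid R M)] at h
    obtain ⟨a, ha, ha0⟩ := h
    exact ha (hker ha0)
  obtain ⟨Q', -, hQ', hQ'm⟩ := Ideal.exists_ideal_over_prime_of_isIntegral
    (S := R') (IsLocalRing.maximalIdeal A') ⊥ (IsLocalRing.le_maximalIdeal (by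
      rw [Ne, Ideal.comap_eq_top_iff]
      exact bot_ne_top))
  refine ⟨Q'.comap (algebraMap R R'), Ideal.IsPrime.comap _, ?_⟩
  rw [Ideal.comap_comap, ← hcomp, ← Ideal.comap_comap, hQ'm]
  exact IsLocalization.AtPrime.under_maximalIdeal A' 𝔮

end LyingOver

/-! ### From generic linear forms to arbitrary ones -/

section Specialization

variable {K : Type*} [Field K] {n r : ℕ}

/-- The linear forms given by the rows of `A` satisfy on `W` a nontrivial polynomial relation of
degree at most `N`. -/
def SatisfyRelation (W : Set (Fin n → K)) (N : ℕ) (A : Matrix (Fin r) (Fin n) K) : Prop :=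
  ∃ P : MvPolynomial (Fin r) K, P ≠ 0 ∧ P.totalDegree ≤ N ∧ ∀ x ∈ W, eval (A.mulVec x) P = 0

/-- If no nontrivial linear combination of finitely many functions vanishes on `W`, then some
evaluation matrix is invertible. -/
theorem exists_det_ne_zero {ι X : Type*} [Fintype ι] [DecidableEq ι] (W : Set X) (f : ι → X → K)
    (hf : ∀ c : ι → K, (∀ x ∈ W, ∑ i, c i * f i x = 0) → c = 0) :
    ∃ x : ι → X, (∀ i, x i ∈ W) ∧ (Matrix.of fun i j => f j (x i)).det ≠ 0 := by
  let v : W → ι → K := fun x i => f i x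
  -- A functional killing all evaluation vectors is a linear combination of the functions vanishing
  -- on `W`. Hence the vectors span, and a basis chosen among them gives the rows.
  have hspan : Submodule.span K (Set.range v) = ⊤ := by
    by_contra hne
    obtain ⟨φ, hφ, hle⟩ := Submodule.exists_le_ker_of_lt_top _ (lt_top_iff_ne_top.mpr hne)
    apply hφ
    have h0 := hf (fun i => φ (Pi.single i 1)) fun x hx => by
      have h1 : φ (v ⟨x, hx⟩) = 0 := hle (Submodule.subset_span ⟨_, rfl⟩)
      rw [LinearMap.pi_apply_eq_sum_univ φ] at h1
      have h2 : ∀ i, (Pi.single i 1 : ι → K) = fun j => if i = j then 1 else 0 := fun i => by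
        funext j
        simp [Pi.single_apply, eq_comm]
      simpa [v, mul_comm, h2] using h1
    refine LinearMap.pi_ext' fun i => LinearMap.ext_ring ?_
    simpa using congrFun h0 i
  obtain ⟨b, hb, hbspan, hbind⟩ := exists_linearIndependent K (Set.range v)
  let B := Module.Basis.mk hbind (by rw [Subtype.range_coe, hbspan, hspan])
  have e : ι ≃ b := (Pi.basisFun K ι).indexEquiv B
  have hmem : ∀ i, ∃ x : W, v x = (e i : ι → K) := fun i => hb (e i).2
  choose x hx using hmem
  refine ⟨fun i => x i, fun i => (x i).2, ?_⟩
  have h1 : LinearIndependent K (Matrix.of fun i j => f j (x i : X)).row := by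
    have h2 : (Matrix.of fun i j => f j (x i : X)).row = fun i => (e i : ι → K) := by
      funext i
      exact hx i
    rw [h2]
    exact hbind.comp e e.injective
  rw [Matrix.linearIndependent_rows_iff_isUnit, Matrix.isUnit_iff_isUnit_det] at h1
  exact h1.ne_zero

/-- If generic linear forms satisfy relations of degree at most `N` on `W`, then all do. -/
theorem satisfyRelation_of_generic [Infinite K] {W : Set (Fin n → K)} {N : ℕ}
    {H : MvPolynomial (Fin r × Fin n) K} (hH : H ≠ 0)
    (h : ∀ A : Matrix (Fin r) (Fin n) K, eval (fun ij => A ij.1 ij.2) H ≠ 0 →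
      SatisfyRelation W N A) (A₀ : Matrix (Fin r) (Fin n) K) : SatisfyRelation W N A₀ := by
  classical
  by_contra hA₀
  let ι := {α : Fin r →₀ ℕ // α.degree ≤ N}
  have : Finite ι := Finsupp.finite_of_degree_le N
  have := Fintype.ofFinite ι
  let f : Matrix (Fin r) (Fin n) K → ι → (Fin n → K) → K :=
    fun A α x => ∏ i, (A.mulVec x i) ^ (α.1 i)
  have hind : ∀ c : ι → K, (∀ x ∈ W, ∑ α, c α * f A₀ α x = 0) → c = 0 := by
    intro c hc
    by_contra hc0
    apply hA₀
    refine ⟨∑ α, monomial α.1 (c α), fun h0 => hc0 ?_, ?_, fun x hx => ?_⟩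
    · funext α
      have := congrArg (coeff α.1) h0
      rw [coeff_sum, Finset.sum_eq_single α (fun β _ hβ => by
        rw [coeff_monomial, if_neg fun h => hβ (Subtype.ext h)]) (by simp)] at this
      simpa using this
    · refine totalDegree_finsetSum_le fun α _ => ?_
      exact (totalDegree_monomial_le _ _).trans α.2
    · rw [← hc x hx, map_sum]
      refine Finset.sum_congr rfl fun α _ => ?_
      rw [eval_monomial, Finsupp.prod_fintype _ _ (by simp)]
  obtain ⟨x, hxW, hdet⟩ := exists_det_ne_zero W (f A₀) hind
  -- The evaluation determinant as a polynomial in the matrix entries, with the points fixed. It is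
  -- nonzero at `A₀`, hence at some `A` with `H` nonzero; there the coefficients of a relation would
  -- lie in the kernel of an invertible matrix.
  let Δ : MvPolynomial (Fin r × Fin n) K :=
    (Matrix.of fun (i j : ι) => ∏ l, (∑ m, X (l, m) * C (x i m)) ^ (j.1 l)).det
  have hΔ : ∀ A : Matrix (Fin r) (Fin n) K, eval (fun ij => A ij.1 ij.2) Δ =
      (Matrix.of fun i j => f A j (x i)).det := by
    intro A
    rw [RingHom.map_det]
    congr 1
    ext i j
    simp [f, Matrix.mulVec, dotProduct]
  have hΔ0 : Δ ≠ 0 := by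
    intro h0
    apply hdet
    rw [← hΔ, h0, map_zero]
  obtain ⟨a, ha⟩ := exists_eval_ne_zero (mul_ne_zero hH hΔ0)
  rw [map_mul] at ha
  let A : Matrix (Fin r) (Fin n) K := fun i j => a (i, j)
  obtain ⟨P, hP0, hPN, hPW⟩ := h A (left_ne_zero_of_mul ha)
  have hdetA : (Matrix.of fun i j => f A j (x i)).det ≠ 0 := by
    rw [← hΔ]
    exact right_ne_zero_of_mul ha
  have hsupp : ∀ α ∈ P.support, α.degree ≤ N := fun α hα =>
    (le_totalDegree hα).trans hPN
  have hmul : (Matrix.of fun i j => f A j (x i)).mulVec (fun α : ι => coeff α.1 P) = 0 := by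
    funext i
    have h1 := hPW (x i) (hxW i)
    rw [eval_eq'] at h1
    simp only [Matrix.mulVec, dotProduct, Matrix.of_apply, Pi.zero_apply, f]
    rw [← h1]
    have himg := Finset.sum_image (s := (Finset.univ : Finset ι)) (g := Subtype.val)
      (f := fun α => coeff α P * ∏ l, (A.mulVec (x i) l) ^ α l)
      (fun _ _ _ _ h => Subtype.ext h)
    refine Eq.trans (Finset.sum_congr rfl fun α _ => mul_comm _ _) (himg.symm.trans ?_)
    refine (Finset.sum_subset (fun α hα => ?_) fun α _ hα => ?_).symm
    · exact Finset.mem_image.mpr ⟨⟨α, hsupp α hα⟩, Finset.mem_univ _, rfl⟩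
    · rw [notMem_support_iff.mp hα, zero_mul]
  have h0 := Matrix.eq_zero_of_mulVec_eq_zero hdetA hmul
  apply hP0
  ext α
  rw [coeff_zero]
  by_contra hne
  exact hne (congrFun h0 ⟨α, hsupp α (mem_support_iff.mpr hne)⟩)

end Specialization

/-! ### Generic shears of an irreducible polynomial -/

section GenericDirection

variable {K : Type*} [Field K] {r : ℕ}

/-- The substitution `X₀ ↦ X₀`, `Xᵢ ↦ Xᵢ + vᵢ X₀` for `i ≥ 1`. -/
noncomputable def shearHom (v : Fin r → K) :
    MvPolynomial (Fin (r + 1)) K →ₐ[K] MvPolynomial (Fin (r + 1)) K :=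
  aeval (Fin.cons (X 0) fun i => X i.succ + C (v i) * X 0)

theorem shearHom_comp_neg (v : Fin r → K) :
    (shearHom v).comp (shearHom (-v)) = AlgHom.id K _ := by
  refine MvPolynomial.algHom_ext fun i => ?_
  refine Fin.cases ?_ (fun i => ?_) i
  · simp [shearHom]
  · simp [shearHom, algHom_C]

/-- The substitution `shearHom` as an automorphism. -/
noncomputable def shearEquiv (v : Fin r → K) :
    MvPolynomial (Fin (r + 1)) K ≃ₐ[K] MvPolynomial (Fin (r + 1)) K :=
  AlgEquiv.ofAlgHom (shearHom v) (shearHom (-v)) (shearHom_comp_neg v) (by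
    simpa using shearHom_comp_neg (-v))

theorem eval_shearEquiv (v : Fin r → K) (z : K) (b : Fin r → K)
    (P : MvPolynomial (Fin (r + 1)) K) :
    eval (Fin.cons z b : Fin (r + 1) → K) (shearEquiv v P) =
      eval (Fin.cons z fun i => b i + v i * z : Fin (r + 1) → K) P := by
  change eval _ (aeval _ P) = _
  rw [← coe_aeval_eq_eval, ← coe_aeval_eq_eval, RingHom.coe_coe, RingHom.coe_coe,
    ← AlgHom.comp_apply]
  congr 1
  refine MvPolynomial.algHom_ext fun i => ?_
  refine Fin.cases ?_ (fun i => ?_) i <;> simp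

/-- The sheared polynomial restricted to a line. -/
theorem map_eval_finSuccEquiv_shearEquiv (v : Fin r → K) (b : Fin r → K)
    (P : MvPolynomial (Fin (r + 1)) K) :
    (finSuccEquiv K r (shearEquiv v P)).map (eval b) =
      aeval (Fin.cons Polynomial.X fun i => Polynomial.C (b i) + Polynomial.C (v i) * Polynomial.X :
        Fin (r + 1) → Polynomial K) P := by
  have h : (Polynomial.mapAlgHom (aeval b : MvPolynomial (Fin r) K →ₐ[K] K)).comp
      ((finSuccEquiv K r).toAlgHom.comp (shearEquiv v).toAlgHom) =
      (aeval (Fin.cons Polynomial.X fun i =>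
        Polynomial.C (b i) + Polynomial.C (v i) * Polynomial.X : Fin (r + 1) → Polynomial K)) := by
    refine MvPolynomial.algHom_ext fun i => ?_
    refine Fin.cases ?_ (fun i => ?_) i
    · simp [shearEquiv, shearHom, finSuccEquiv_X_zero]
    · simp [shearEquiv, shearHom, finSuccEquiv_apply]
  have h' := DFunLike.congr_fun h P
  simpa [coe_aeval_eq_eval] using h'

theorem eval_smul_of_isHomogeneous {σ : Type*} {p : MvPolynomial σ K} {e : ℕ}
    (hp : p.IsHomogeneous e) (c : K) (w : σ → K) : eval (c • w) p = c ^ e * eval w p := by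
  rw [eval_eq, eval_eq, Finset.mul_sum]
  refine Finset.sum_congr rfl fun α hα => ?_
  have h1 : ∑ i ∈ α.support, α i = e := by
    have := hp (mem_support_iff.mp hα)
    rw [Finsupp.weight_apply, Finsupp.sum] at this
    simpa using this
  simp only [Pi.smul_apply, smul_eq_mul, mul_pow, Finset.prod_mul_distrib]
  rw [Finset.prod_pow_eq_pow_sum, h1]
  ring

/-- After a generic shear, an irreducible polynomial over a perfect field has maximal degree in
the variable `X₀` and is separable with respect to it. -/
theorem exists_shear [Infinite K] [PerfectField K] {P : MvPolynomial (Fin (r + 1)) K}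
    (hP : Irreducible P) {q : MvPolynomial (Fin r) K} (hq : q ≠ 0) :
    ∃ v : Fin r → K, eval v q ≠ 0 ∧
      (finSuccEquiv K r (shearEquiv v P)).natDegree = P.totalDegree ∧
      Polynomial.derivative (finSuccEquiv K r (shearEquiv v P)) ≠ 0 := by
  set e := P.totalDegree with he
  have htop : homogeneousComponent e P ≠ 0 := by
    intro h0
    have hP0 := hP.ne_zero
    obtain ⟨α, hα, hαe⟩ := Finset.exists_mem_eq_sup P.support
      (Finset.nonempty_of_ne_empty fun h => hP0 (support_eq_empty.mp h))
      (fun s : Fin (r + 1) →₀ ℕ => s.sum fun _ e => e)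
    have h1 := congrArg (coeff α) h0
    rw [coeff_homogeneousComponent, coeff_zero, if_pos] at h1
    · exact mem_support_iff.mp hα h1
    · exact hαe.symm
  obtain ⟨i₀, hi₀⟩ := exists_pderiv_ne_zero hP
  obtain ⟨a, ha⟩ := exists_eval_ne_zero hi₀
  -- `q₂ v` is the top form of `P` at `(1, v)`, which is the coefficient of X₀^e after the shear, at
  -- the origin of the other variables. `q₃ v` is the derivative of `P` at `a` in direction `(1,
  -- v)`.
  let q₂ : MvPolynomial (Fin r) K := aeval (Fin.cons 1 X) (homogeneousComponent e P)
  let q₃ : MvPolynomial (Fin r) K :=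
    C (eval a (pderiv 0 P)) + ∑ i : Fin r, C (eval a (pderiv i.succ P)) * X i
  have hq₂e : ∀ v, eval v q₂ = eval (Fin.cons 1 v : Fin (r + 1) → K)
      (homogeneousComponent e P) := by
    intro v
    simp only [q₂]
    rw [← coe_aeval_eq_eval, ← coe_aeval_eq_eval, RingHom.coe_coe, RingHom.coe_coe,
      ← AlgHom.comp_apply]
    congr 1
    refine MvPolynomial.algHom_ext fun i => ?_
    refine Fin.cases ?_ (fun i => ?_) i <;> simp
  have hq₂ : q₂ ≠ 0 := by
    -- The factor X₀ ensures `w 0 ≠ 0`, so homogeneity allows rescaling `w` to first coordinate 1.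
    obtain ⟨w, hw⟩ := exists_eval_ne_zero (mul_ne_zero htop (X_ne_zero (0 : Fin (r + 1))))
    rw [map_mul, eval_X] at hw
    have hw0 := right_ne_zero_of_mul hw
    intro h0
    have h1 := hq₂e fun i => (w 0)⁻¹ * w i.succ
    rw [h0, map_zero] at h1
    have h2 : w = w 0 • (Fin.cons 1 fun i => (w 0)⁻¹ * w i.succ : Fin (r + 1) → K) := by
      funext i
      refine Fin.cases ?_ (fun i => ?_) i
      · simp
      · simp [hw0]
    apply left_ne_zero_of_mul hw
    rw [h2, eval_smul_of_isHomogeneous (homogeneousComponent_isHomogeneous e P), ← h1, mul_zero]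
  have hq₃e : ∀ v, eval v q₃ = eval a (pderiv 0 P) + ∑ i : Fin r, eval a (pderiv i.succ P) * v i :=
    fun v => by simp [q₃]
  have hq₃ : q₃ ≠ 0 := by
    intro h0
    simp only [h0, map_zero] at hq₃e
    have h00 : eval a (pderiv 0 P) = 0 := by simpa using (hq₃e 0).symm
    revert ha
    refine Fin.cases (fun h => h h00) (fun i h => h ?_) i₀
    have h1 := hq₃e (Pi.single i 1)
    rw [h00, Finset.sum_eq_single i (fun j _ hj => by simp [hj]) (by simp)] at h1
    simpa using h1.symm
  obtain ⟨v, hv⟩ := exists_eval_ne_zero (mul_ne_zero (mul_ne_zero hq hq₂) hq₃)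
  rw [map_mul, map_mul] at hv
  have hv₂ := right_ne_zero_of_mul (left_ne_zero_of_mul hv)
  have hv₃ := right_ne_zero_of_mul hv
  refine ⟨v, left_ne_zero_of_mul (left_ne_zero_of_mul hv), ?_, fun hder => ?_⟩
  · apply le_antisymm
    · rw [natDegree_finSuccEquiv]
      refine (degreeOf_le_totalDegree _ _).trans ?_
      refine totalDegree_aeval_le_of_totalDegree_le_one _ (fun i => ?_) P
      refine Fin.cases ?_ (fun i => ?_) i
      · simp
      · refine (totalDegree_add _ _).trans (max_le (by simp) ?_)
        refine (totalDegree_mul _ _).trans ?_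
        simp
    · apply Polynomial.le_natDegree_of_ne_zero
      intro h0
      apply hv₂
      rw [hq₂e, ← coeff_aeval_C_mul_X]
      have h1 := map_eval_finSuccEquiv_shearEquiv v 0 P
      have h2 : (Fin.cons Polynomial.X fun i => Polynomial.C ((0 : Fin r → K) i) +
          Polynomial.C (v i) * Polynomial.X : Fin (r + 1) → Polynomial K) =
          fun i => Polynomial.C ((Fin.cons 1 v : Fin (r + 1) → K) i) * Polynomial.X := by
        funext i
        refine Fin.cases ?_ (fun i => ?_) i <;> simp
      rw [h2] at h1
      rw [← h1, Polynomial.coeff_map, h0, map_zero]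
  · apply hv₃
    rw [hq₃e]
    -- With this base point, the line in direction `(1, v)` passes through `a` at parameter `a 0`.
    have h1 := map_eval_finSuccEquiv_shearEquiv v (fun i => a i.succ - v i * a 0) P
    have h2 := congrArg Polynomial.derivative h1
    rw [Polynomial.derivative_map, hder, Polynomial.map_zero, derivative_aeval] at h2
    have h3 := congrArg (Polynomial.eval (a 0)) h2
    have h4 : ∀ Q : MvPolynomial (Fin (r + 1)) K, Polynomial.eval (a 0) (aeval
        (Fin.cons Polynomial.X fun i => Polynomial.C (a i.succ - v i * a 0) +
          Polynomial.C (v i) * Polynomial.X : Fin (r + 1) → Polynomial K) Q) = eval a Q := by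
      intro Q
      rw [← Polynomial.coe_aeval_eq_eval, ← coe_aeval_eq_eval, RingHom.coe_coe,
        ← AlgHom.comp_apply]
      congr 1
      refine MvPolynomial.algHom_ext fun i => ?_
      refine Fin.cases ?_ (fun i => ?_) i <;> simp
    rw [Polynomial.eval_zero, Polynomial.eval_finsetSum, Fin.sum_univ_succ] at h3
    simp only [Polynomial.eval_mul, h4] at h3
    simpa using h3.symm

end GenericDirection

/-! ### Lifting points along a linear projection -/

section Lifting

variable {K : Type*} [Field K] {n m : ℕ}

/-- The linear forms given by the rows of a matrix. -/
noncomputable def linForm (A : Matrix (Fin m) (Fin n) K) (i : Fin m) : MvPolynomial (Fin n) K :=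
  ∑ j, C (A i j) * X j

theorem eval_linForm (A : Matrix (Fin m) (Fin n) K) (x : Fin n → K) (i : Fin m) :
    eval x (linForm A i) = A.mulVec x i := by
  simp [linForm, Matrix.mulVec, dotProduct]

theorem eval_aeval_linForm (A : Matrix (Fin m) (Fin n) K) (x : Fin n → K)
    (q : MvPolynomial (Fin m) K) : eval x (aeval (linForm A) q) = eval (A.mulVec x) q := by
  rw [← coe_aeval_eq_eval, ← coe_aeval_eq_eval, RingHom.coe_coe, RingHom.coe_coe,
    ← AlgHom.comp_apply]
  congr 1
  refine MvPolynomial.algHom_ext fun i => ?_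
  simp [eval_linForm]

/-- Points of the closure of the image of `W` under a linear map lift to `W` wherever `W` is
integral over the image. -/
theorem exists_mem_mulVec_eq [IsAlgClosed K] {W : Set (Fin n → K)} (hW : IsAffineVariety K W)
    (L : Matrix (Fin m) (Fin n) K) (a : Fin m → K)
    (hker : ∀ q : MvPolynomial (Fin m) K, (∀ x ∈ W, eval (L.mulVec x) q = 0) → eval a q = 0)
    (halg : ∀ j : Fin n, ∃ q : Polynomial (MvPolynomial (Fin m) K), eval a q.leadingCoeff ≠ 0 ∧
      ∀ x ∈ W, (q.map (eval (L.mulVec x))).eval (x j) = 0) :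
    ∃ x ∈ W, L.mulVec x = a := by
  let I := vanishingIdeal K W
  let y : Fin m → CoordinateRing K W := fun i => Ideal.Quotient.mk I (linForm L i)
  let _ : Algebra (MvPolynomial (Fin m) K) (CoordinateRing K W) := (aeval y).toAlgebra
  have hmk : ∀ q : MvPolynomial (Fin m) K,
      algebraMap (MvPolynomial (Fin m) K) (CoordinateRing K W) q =
        Ideal.Quotient.mk I (aeval (linForm L) q) := by
    intro q
    change aeval y q = (Ideal.Quotient.mkₐ K I) (aeval (linForm L) q)
    rw [← AlgHom.comp_apply]
    congr 1
    refine MvPolynomial.algHom_ext fun i => ?_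
    simp [y]
  have hzero : ∀ q : MvPolynomial (Fin m) K,
      algebraMap (MvPolynomial (Fin m) K) (CoordinateRing K W) q = 0 ↔
        ∀ x ∈ W, eval (L.mulVec x) q = 0 := by
    intro q
    rw [hmk, Ideal.Quotient.eq_zero_iff_mem]
    refine forall₂_congr fun x _ => ?_
    rw [← eval_aeval_linForm, ← coe_aeval_eq_eval, RingHom.coe_coe]
  let 𝔮 : Ideal (MvPolynomial (Fin m) K) := vanishingIdeal K {a}
  have hmem𝔮 : ∀ q, q ∈ 𝔮 ↔ eval a q = 0 := fun q => by
    rw [mem_vanishingIdeal_singleton_iff, ← coe_aeval_eq_eval, RingHom.coe_coe]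
  obtain ⟨Q, hQ, hQ𝔮⟩ := exists_prime_comap_eq_of_leadingCoeff_notMem 𝔮
    (fun q hq => (hmem𝔮 q).mpr (hker q ((hzero q).mp hq)))
    (Set.range fun j => Ideal.Quotient.mk I (X j)) (by
      rw [eq_top_iff]
      rintro z -
      obtain ⟨z, rfl⟩ := Ideal.Quotient.mk_surjective z
      induction z using MvPolynomial.induction_on with
      | C c =>
        have : Ideal.Quotient.mk I (C c) = algebraMap (MvPolynomial (Fin m) K)
            (CoordinateRing K W) (C c) := by
          rw [hmk, algHom_C]
          rfl
        rw [this]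
        exact Subalgebra.algebraMap_mem _ _
      | add p q hp hq => rw [map_add]; exact add_mem hp hq
      | mul_X p j hp =>
        rw [map_mul]
        exact mul_mem hp (Algebra.subset_adjoin ⟨j, rfl⟩)) (by
      rintro _ ⟨j, rfl⟩
      obtain ⟨q, hqa, hq⟩ := halg j
      refine ⟨q, fun h => hqa ((hmem𝔮 _).mp h), ?_⟩
      have h1 : Polynomial.aeval (Ideal.Quotient.mk I (X j)) q =
          Ideal.Quotient.mk I (Polynomial.eval₂ (aeval (linForm L) :
            MvPolynomial (Fin m) K →ₐ[K] MvPolynomial (Fin n) K).toRingHom (X j) q) := by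
        rw [Polynomial.aeval_def, Polynomial.hom_eval₂]
        congr 1
        exact RingHom.ext hmk
      rw [h1, Ideal.Quotient.eq_zero_iff_mem]
      intro x hx
      rw [← hq x hx, Polynomial.eval_map, ← RingHom.coe_coe, Polynomial.hom_eval₂]
      simp only [RingHom.coe_coe, aeval_X]
      congr 1
      refine RingHom.ext fun p => ?_
      rw [← eval_aeval_linForm, ← coe_aeval_eq_eval]
      rfl)
  -- By the Nullstellensatz a maximal ideal above `Q` is a point `x` of `W`; since `Q` lies over the
  -- ideal of `a`, its image is `a`.
  obtain ⟨M, hM, hQM⟩ := Ideal.exists_le_maximal Q hQ.ne_top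
  have hMc : (M.comap (Ideal.Quotient.mk I)).IsMaximal :=
    Ideal.comap_isMaximal_of_surjective _ Ideal.Quotient.mk_surjective
  obtain ⟨x, hx⟩ := eq_vanishingIdeal_singleton_of_isMaximal K hMc
  have hmemx : ∀ p, Ideal.Quotient.mk I p ∈ M → eval x p = 0 := fun p hp => by
    have : p ∈ M.comap (Ideal.Quotient.mk I) := hp
    rwa [hx, mem_vanishingIdeal_singleton_iff, ← RingHom.coe_coe, coe_aeval_eq_eval] at this
  refine ⟨x, ?_, ?_⟩
  · rw [← isAffineVariety_iff.mp hW]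
    intro p hp
    rw [← RingHom.coe_coe, coe_aeval_eq_eval]
    apply hmemx
    rw [Ideal.Quotient.eq_zero_iff_mem.mpr hp]
    exact zero_mem M
  · funext i
    have h1 : X i - C (a i) ∈ 𝔮 := by
      rw [hmem𝔮]
      simp
    rw [← hQ𝔮, Ideal.mem_comap, hmk] at h1
    have h2 := hmemx _ (hQM h1)
    rw [eval_aeval_linForm] at h2
    simpa [sub_eq_zero] using h2

end Lifting

/-! ### Degree as a bound for equations in k + 1 coordinates -/

section Degree

variable {K : Type*} [Field K] {n r : ℕ}

/-- Evaluation of a polynomial in the coefficients `(A, b)` of a linear system. -/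
noncomputable def evalSystem (A : Matrix (Fin r) (Fin n) K) (b : Fin r → K)
    (G : MvPolynomial ((Fin r × Fin n) ⊕ Fin r) K) : K :=
  eval (Sum.elim (fun ij => A ij.1 ij.2) b) G

/-- The matrix with first row `A₀` and further rows `Aᵢ - vᵢ A₀`. -/
def shearMatrix (A : Matrix (Fin (r + 1)) (Fin n) K) (v : Fin r → K) :
    Matrix (Fin r) (Fin n) K :=
  fun i j => A i.succ j - v i * A 0 j

theorem shearMatrix_mulVec (A : Matrix (Fin (r + 1)) (Fin n) K) (v : Fin r → K) (x : Fin n → K)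
    (i : Fin r) : (shearMatrix A v).mulVec x i = A.mulVec x i.succ - v i * A.mulVec x 0 := by
  simp [shearMatrix, Matrix.mulVec, dotProduct, sub_mul, Finset.sum_sub_distrib, Finset.mul_sum,
    mul_assoc]

theorem cons_shearMatrix_mulVec (A : Matrix (Fin (r + 1)) (Fin n) K) (v : Fin r → K)
    (x : Fin n → K) :
    Matrix.mulVec (Fin.cons (A 0) (shearMatrix A v) : Matrix (Fin (r + 1)) (Fin n) K) x =
      (Fin.cons (A.mulVec x 0) ((shearMatrix A v).mulVec x) : Fin (r + 1) → K) := by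
  funext i
  refine Fin.cases ?_ (fun i => ?_) i <;> rfl

theorem exists_evalSystem_ne_zero [Infinite K] {G : MvPolynomial ((Fin r × Fin n) ⊕ Fin r) K}
    (hG : G ≠ 0) : ∃ A b, evalSystem A b G ≠ 0 := by
  obtain ⟨a, ha⟩ := exists_eval_ne_zero hG
  refine ⟨fun i j => a (Sum.inl (i, j)), fun i => a (Sum.inr i), ?_⟩
  have h : (Sum.elim (fun ij : Fin r × Fin n => a (Sum.inl (ij.1, ij.2)))
      fun i => a (Sum.inr i)) = a := by
    funext i
    rcases i with i | i <;> rfl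
  change eval (Sum.elim (fun ij : Fin r × Fin n => a (Sum.inl (ij.1, ij.2)))
    fun i => a (Sum.inr i)) G ≠ 0
  rwa [h]

/-- The polynomial `G(A, ·)`. -/
noncomputable def fixMatrix (A : Matrix (Fin r) (Fin n) K)
    (G : MvPolynomial ((Fin r × Fin n) ⊕ Fin r) K) : MvPolynomial (Fin r) K :=
  aeval (Sum.elim (fun ij => C (A ij.1 ij.2)) X) G

theorem eval_fixMatrix (A : Matrix (Fin r) (Fin n) K) (b : Fin r → K)
    (G : MvPolynomial ((Fin r × Fin n) ⊕ Fin r) K) :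
    eval b (fixMatrix A G) = evalSystem A b G := by
  rw [fixMatrix, evalSystem, ← coe_aeval_eq_eval, ← coe_aeval_eq_eval, RingHom.coe_coe,
    RingHom.coe_coe, ← AlgHom.comp_apply]
  congr 1
  refine MvPolynomial.algHom_ext fun i => ?_
  rcases i with i | i <;> simp

theorem totalDegree_fixMatrix_le (A : Matrix (Fin r) (Fin n) K)
    (G : MvPolynomial ((Fin r × Fin n) ⊕ Fin r) K) :
    (fixMatrix A G).totalDegree ≤ G.totalDegree :=
  totalDegree_aeval_le_of_totalDegree_le_one _ (fun i => by rcases i with i | i <;> simp) G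

/-- The polynomial `G(·, b)`. -/
noncomputable def fixVector (b : Fin r → K)
    (G : MvPolynomial ((Fin r × Fin n) ⊕ Fin r) K) : MvPolynomial (Fin r × Fin n) K :=
  aeval (Sum.elim X (fun i => C (b i))) G

theorem eval_fixVector (A : Matrix (Fin r) (Fin n) K) (b : Fin r → K)
    (G : MvPolynomial ((Fin r × Fin n) ⊕ Fin r) K) :
    eval (fun ij => A ij.1 ij.2) (fixVector b G) = evalSystem A b G := by
  rw [fixVector, evalSystem, ← coe_aeval_eq_eval, ← coe_aeval_eq_eval, RingHom.coe_coe,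
    RingHom.coe_coe, ← AlgHom.comp_apply]
  congr 1
  refine MvPolynomial.algHom_ext fun i => ?_
  rcases i with i | i <;> simp

/-- A linear system through a point of `W` can be chosen generic. -/
theorem exists_mem_evalSystem_ne_zero [Infinite K] {W : Set (Fin n → K)}
    {A₀ : Matrix (Fin r) (Fin n) K} (hA₀ : ∀ N, ¬ SatisfyRelation W N A₀)
    {G : MvPolynomial ((Fin r × Fin n) ⊕ Fin r) K} (hG : G ≠ 0) :
    ∃ A : Matrix (Fin r) (Fin n) K, ∃ x ∈ W, evalSystem A (A.mulVec x) G ≠ 0 := by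
  by_contra! h
  obtain ⟨A₁, b, hA₁⟩ := exists_evalSystem_ne_zero hG
  -- If `G` vanished on every system through a point of `W`, then `G(A, ·)` would be a relation for
  -- generic `A`, of degree bounded independently of `A`, and would specialize to `A₀`.
  refine hA₀ G.totalDegree (satisfyRelation_of_generic (H := fixVector b G) ?_ (fun A hA => ?_) A₀)
  · intro h0
    rw [← eval_fixVector, h0, map_zero] at hA₁
    exact hA₁ rfl
  · rw [eval_fixVector] at hA
    refine ⟨fixMatrix A G, ?_, totalDegree_fixMatrix_le A G, fun x hx => ?_⟩
    · intro h0
      rw [← eval_fixMatrix, h0, map_zero] at hA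
      exact hA rfl
    · rw [eval_fixMatrix]
      exact h A x hx

/-- Generic forms satisfy a relation whose degree is bounded by the number of points of a generic
linear section. -/
theorem satisfyRelation_of_evalSystem_ne_zero [IsAlgClosed K] {W : Set (Fin n → K)}
    (hW : IsIrreducibleVariety K W)
    (hdep : ∀ z : Fin (r + 1) → MvPolynomial (Fin n) K, ∃ T : MvPolynomial (Fin (r + 1)) K,
      T ≠ 0 ∧ ∀ x ∈ W, eval (fun i => eval x (z i)) T = 0)
    {G : MvPolynomial ((Fin r × Fin n) ⊕ Fin r) K} {δ : ℕ} (hδ : δ ≠ 0)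
    (hG : ∀ A b, evalSystem A b G ≠ 0 → (W ∩ {x | A.mulVec x = b}).encard = δ)
    (A : Matrix (Fin (r + 1)) (Fin n) K) (b₀ : Fin r → K)
    (hA : evalSystem (fun i => A i.succ) b₀ G ≠ 0) : SatisfyRelation W δ A := by
  classical
  have hinf : Infinite K := IsAlgClosed.instInfinite
  have hprime := hW.isPrime
  -- an irreducible relation between the forms
  let 𝔭 : Ideal (MvPolynomial (Fin (r + 1)) K) := (vanishingIdeal K W).comap (aeval (linForm A))
  have h𝔭 : 𝔭.IsPrime := Ideal.IsPrime.comap _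
  have hmem𝔭 : ∀ q, q ∈ 𝔭 ↔ ∀ x ∈ W, eval (A.mulVec x) q = 0 := fun q => by
    refine forall₂_congr fun x _ => ?_
    rw [← eval_aeval_linForm, ← coe_aeval_eq_eval]
    rfl
  have h𝔭0 : 𝔭 ≠ ⊥ := by
    obtain ⟨T, hT0, hT⟩ := hdep (linForm A)
    simp only [eval_linForm] at hT
    intro h0
    have : T ∈ 𝔭 := (hmem𝔭 T).mpr hT
    rw [h0] at this
    exact hT0 this
  obtain ⟨P, hP𝔭, hPprime⟩ := h𝔭.exists_mem_prime_of_ne_bot h𝔭0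
  have hP := hPprime.irreducible
  rw [hmem𝔭] at hP𝔭
  refine ⟨P, hP.ne_zero, ?_, hP𝔭⟩
  -- a generic projection direction
  let q₁ : MvPolynomial (Fin r) K := aeval (Sum.elim
    (fun ij => C (A ij.1.succ ij.2) - X ij.1 * C (A 0 ij.2)) (fun i => C (b₀ i))) G
  have hq₁e : ∀ v, eval v q₁ = evalSystem (shearMatrix A v) b₀ G := by
    intro v
    rw [evalSystem, ← coe_aeval_eq_eval, ← coe_aeval_eq_eval, RingHom.coe_coe,
      RingHom.coe_coe, ← AlgHom.comp_apply]
    congr 1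
    refine MvPolynomial.algHom_ext fun i => ?_
    rcases i with i | i <;> simp [shearMatrix]
  have hq₁ : q₁ ≠ 0 := by
    intro h0
    have h1 := hq₁e 0
    rw [h0, map_zero] at h1
    apply hA
    rw [h1]
    congr 1
    ext i j
    simp [shearMatrix]
  obtain ⟨v, hv, hdeg, hder⟩ := exists_shear hP hq₁
  rw [hq₁e] at hv
  set A' := shearMatrix A v with hA'
  set p := finSuccEquiv K r (shearEquiv v P) with hp
  have hpirr : Irreducible p :=
    (MulEquiv.irreducible_iff (finSuccEquiv K r)).mpr
      ((MulEquiv.irreducible_iff (shearEquiv v)).mpr hP)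
  have hdeg0 : p.natDegree ≠ 0 := by
    rw [hdeg]
    intro h0
    rw [totalDegree_eq_zero_iff_eq_C.mp h0] at hP
    have hc : coeff 0 P ≠ 0 := fun h => hP.ne_zero (by rw [h, C_0])
    exact hP.not_isUnit ((isUnit_iff_ne_zero.mpr hc).map C)
  -- As `δ ≠ 0`, generic sections are nonempty: the image of `W` under `A'` meets every nonempty
  -- open set on which `G(A', ·)` is nonzero, so no nonzero `T` vanishes on it.
  have hind : ∀ T : MvPolynomial (Fin r) K, (∀ x ∈ W, eval (A'.mulVec x) T = 0) → T = 0 := by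
    intro T hT
    by_contra hT0
    have hfix : fixMatrix A' G ≠ 0 := by
      intro h0
      rw [← eval_fixMatrix, h0, map_zero] at hv
      exact hv rfl
    obtain ⟨b, hb⟩ := exists_eval_ne_zero (mul_ne_zero hT0 hfix)
    rw [map_mul, eval_fixMatrix] at hb
    have h1 := hG A' b (right_ne_zero_of_mul hb)
    have h2 : (W ∩ {x | A'.mulVec x = b}).Nonempty := by
      rw [← Set.encard_ne_zero, h1]
      exact_mod_cast hδ
    obtain ⟨x, hxW, hxb⟩ := h2
    apply left_ne_zero_of_mul hb
    rw [← hxb]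
    exact hT x hxW
  -- The shear of `P` undoes the shear of the matrix: adding `v i` times the first form to the
  -- `i`-th new form recovers the old one.
  have hpW : ∀ x ∈ W, (p.map (eval (A'.mulVec x))).eval (A.mulVec x 0) = 0 := by
    intro x hx
    rw [← eval_eq_eval_mv_eval', eval_shearEquiv, ← hP𝔭 x hx]
    congr 2
    funext i
    refine Fin.cases rfl (fun i => ?_) i
    simp [hA', shearMatrix_mulVec]
  -- every relation between the new forms is a multiple of `p`
  have hdvd : ∀ q : Polynomial (MvPolynomial (Fin r) K),
      (∀ x ∈ W, (q.map (eval (A'.mulVec x))).eval (A.mulVec x 0) = 0) → p ∣ q := by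
    intro q hq
    by_contra hndvd
    -- Otherwise eliminating the first form leaves a nonzero relation `c` between the independent
    -- new forms.
    obtain ⟨u, w, c, hc, huw⟩ := exists_mul_add_mul_eq_C hpirr hdeg0 hndvd
    refine hc (hind c fun x hx => ?_)
    have h1 := congrArg (fun s => (Polynomial.map (eval (A'.mulVec x)) s).eval (A.mulVec x 0)) huw
    simp only [Polynomial.map_add, Polynomial.map_mul, Polynomial.eval_add, Polynomial.eval_mul,
      hpW x hx, hq x hx, Polynomial.map_C, Polynomial.eval_C, mul_zero, add_zero] at h1
    exact h1.symm
  have hndvd : ¬ p ∣ Polynomial.derivative p := fun h =>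
    absurd (Polynomial.natDegree_le_of_dvd h hder)
      (not_le.mpr (Polynomial.natDegree_derivative_lt hdeg0))
  -- `c` stands in for the discriminant: `p` specializes to a separable polynomial wherever `c` is
  -- nonzero.
  obtain ⟨u, w, c, hc, huw⟩ := exists_mul_add_mul_eq_C hpirr hdeg0 hndvd
  -- the coordinates are algebraic over the new forms
  have hcoord : ∀ j : Fin n, ∃ q : Polynomial (MvPolynomial (Fin r) K), q ≠ 0 ∧
      ∀ x ∈ W, (q.map (eval (A'.mulVec x))).eval (x j) = 0 := by
    intro j
    obtain ⟨T, hT0, hT⟩ := hdep (Fin.cons (X j) (linForm A'))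
    refine ⟨finSuccEquiv K r T, by simpa using hT0, fun x hx => ?_⟩
    rw [← eval_eq_eval_mv_eval', ← hT x hx]
    congr 2
    funext i
    refine Fin.cases ?_ (fun i => ?_) i
    · simp
    · simp [eval_linForm]
  choose q hq0 hq using hcoord
  -- a generic point
  have hprod : c * p.leadingCoeff * (∏ j, (q j).leadingCoeff) * fixMatrix A' G ≠ 0 := by
    refine mul_ne_zero (mul_ne_zero (mul_ne_zero hc ?_) ?_) ?_
    · exact Polynomial.leadingCoeff_ne_zero.mpr hpirr.ne_zero
    · exact Finset.prod_ne_zero_iff.mpr fun j _ => Polynomial.leadingCoeff_ne_zero.mpr (hq0 j)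
    · intro h0
      rw [← eval_fixMatrix, h0, map_zero] at hv
      exact hv rfl
  obtain ⟨b, hb⟩ := exists_eval_ne_zero hprod
  simp only [map_mul, map_prod, eval_fixMatrix, mul_ne_zero_iff, Finset.prod_ne_zero_iff,
    Finset.mem_univ, true_imp_iff] at hb
  -- Respectively: distinct roots, no drop of degree, integrality of the coordinates above `b`, and
  -- a section of exactly `δ` points.
  obtain ⟨⟨⟨hbc, hbp⟩, hbq⟩, hbG⟩ := hb
  have hpb : (p.map (eval b)).natDegree = P.totalDegree := by
    rw [Polynomial.natDegree_map_of_leadingCoeff_ne_zero _ hbp, hdeg]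
  have hsep : (p.map (eval b)).Separable := by
    refine ⟨Polynomial.C (eval b c)⁻¹ * u.map (eval b), Polynomial.C (eval b c)⁻¹ *
      w.map (eval b), ?_⟩
    have h1 := congrArg (Polynomial.map (eval b)) huw
    simp only [Polynomial.map_add, Polynomial.map_mul, Polynomial.map_C] at h1
    rw [Polynomial.derivative_map, mul_assoc, mul_assoc, ← mul_add, h1, ← Polynomial.C_mul,
      inv_mul_cancel₀ hbc, Polynomial.C_1]
  have hcard : (p.map (eval b)).roots.toFinset.card = P.totalDegree := by
    rw [Multiset.toFinset_card_of_nodup (Polynomial.nodup_roots hsep),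
      IsAlgClosed.card_roots_eq_natDegree, hpb]
  -- every root is the value of the first form at a point of the section
  have hlift : ∀ z ∈ (p.map (eval b)).roots.toFinset,
      ∃ x ∈ W ∩ {x | A'.mulVec x = b}, A.mulVec x 0 = z := by
    intro z hz
    rw [Multiset.mem_toFinset] at hz
    have hz' := Polynomial.isRoot_of_mem_roots hz
    -- The point `(z, b)` is in the closure of the image of `W`, because every relation there is a
    -- multiple of `p`, which vanishes at it.
    obtain ⟨x, hxW, hx⟩ := exists_mem_mulVec_eq hW.1
      (Fin.cons (A 0) A' : Matrix (Fin (r + 1)) (Fin n) K) (Fin.cons z b) (fun s hs => by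
        rw [eval_eq_eval_mv_eval']
        obtain ⟨t, ht⟩ := hdvd (finSuccEquiv K r s) fun x hx => by
          have := hs x hx
          rwa [hA', cons_shearMatrix_mulVec, eval_eq_eval_mv_eval'] at this
        rw [ht, Polynomial.map_mul, Polynomial.eval_mul, hz'.eq_zero, zero_mul]) (fun j => by
        refine ⟨(q j).map (rename Fin.succ).toRingHom, ?_, fun x hx => ?_⟩
        · rw [Polynomial.leadingCoeff_map_of_injective (rename_injective _ (Fin.succ_injective r))]
          change eval _ (rename Fin.succ (q j).leadingCoeff) ≠ 0
          rw [eval_rename]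
          exact hbq j
        · rw [← hq j x hx, Polynomial.map_map, hA', cons_shearMatrix_mulVec]
          congr 2
          refine RingHom.ext fun s => ?_
          change eval _ (rename Fin.succ s) = _
          rw [eval_rename]
          rfl)
    rw [hA', cons_shearMatrix_mulVec] at hx
    refine ⟨x, ⟨hxW, ?_⟩, ?_⟩
    · funext i
      simpa using congrFun hx i.succ
    · simpa using congrFun hx 0
  choose! g hg hgz using hlift
  have hinj : Set.InjOn g ((p.map (eval b)).roots.toFinset : Set K) := by
    intro z hz z' hz' h
    rw [← hgz z hz, ← hgz z' hz', h]
  have hle := Set.encard_le_encard (s := Set.image g ((p.map (eval b)).roots.toFinset : Set K))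
    (t := W ∩ {x | A'.mulVec x = b}) (by
      rintro _ ⟨z, hz, rfl⟩
      exact hg z hz)
  rw [hinj.encard_image, Set.encard_coe_eq_coe_finsetCard, hcard, hG A' b hbG] at hle
  exact_mod_cast hle

/-- Maximal rank can be absorbed into the condition of general position. -/
theorem exists_evalSystem_encard_eq {W : Set (Fin n → K)} {D : ℕ∞}
    (h : GeneralSectionCount W r D) {c : Fin r → Fin n} (hc : Function.Injective c) :
    ∃ G : MvPolynomial ((Fin r × Fin n) ⊕ Fin r) K, G ≠ 0 ∧
      ∀ A b, evalSystem A b G ≠ 0 → (W ∩ {x | A.mulVec x = b}).encard = D := by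
  obtain ⟨G, hG0, hG⟩ := h
  -- An `r × r` minor, whose nonvanishing forces rank `r`; injectivity of `c` makes it a nonzero
  -- polynomial.
  let Δ : MvPolynomial ((Fin r × Fin n) ⊕ Fin r) K :=
    (Matrix.of fun i j => X (Sum.inl (i, c j))).det
  have hΔ : ∀ A b, evalSystem A b Δ = (A.submatrix id c).det := by
    intro A b
    rw [evalSystem, RingHom.map_det]
    congr 1
    ext i j
    simp
  refine ⟨G * Δ, mul_ne_zero hG0 fun h0 => ?_, fun A b hA => ?_⟩
  · have h1 := hΔ (Matrix.of fun i j => if c i = j then 1 else 0) 0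
    have h2 : (Matrix.of fun i j => if c i = j then (1 : K) else 0).submatrix id c =
        (1 : Matrix (Fin r) (Fin r) K) := by
      ext i j
      simp [Matrix.one_apply, hc.eq_iff]
    rw [h2, h0, evalSystem, map_zero, Matrix.det_one] at h1
    exact zero_ne_one h1
  · rw [evalSystem, map_mul] at hA
    refine hG A b ?_ (left_ne_zero_of_mul hA)
    have h1 : (A.submatrix id c).det ≠ 0 := by
      rw [← hΔ A b]
      exact right_ne_zero_of_mul hA
    have h2 : (A.submatrix id c).rank = r := by
      have := Matrix.rank_of_isUnit _ ((Matrix.isUnit_iff_isUnit_det _).mpr h1.isUnit)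
      simpa using this
    refine le_antisymm (A.rank_le_height) ?_
    conv_lhs => rw [← h2]
    exact A.rank_submatrix_le id c

theorem aeval_mk_eq_zero_iff {W : Set (Fin n → K)} {ι : Type*} (z : ι → MvPolynomial (Fin n) K)
    (T : MvPolynomial ι K) :
    aeval (fun i => Ideal.Quotient.mk (vanishingIdeal K W) (z i)) T = 0 ↔
      ∀ x ∈ W, eval (fun i => eval x (z i)) T = 0 := by
  have h1 : aeval (fun i => Ideal.Quotient.mk (vanishingIdeal K W) (z i)) T =
      Ideal.Quotient.mkₐ K (vanishingIdeal K W) (aeval z T) := by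
    rw [← AlgHom.comp_apply]
    congr 1
    refine MvPolynomial.algHom_ext fun i => ?_
    simp
  rw [h1, Ideal.Quotient.mkₐ_eq_mk, Ideal.Quotient.eq_zero_iff_mem]
  refine forall₂_congr fun x _ => ?_
  rw [← AlgHom.comp_apply, ← coe_aeval_eq_eval, RingHom.coe_coe]
  refine Eq.congr (DFunLike.congr_fun ?_ T) rfl
  refine MvPolynomial.algHom_ext fun i => ?_
  simp

/-- The infimum of the empty set is `⊤`, so finiteness gives a nonempty set of counts, whose infimum
is attained. -/
theorem exists_generalSectionCount_of_irreducibleDegree_ne_top {W : Set (Fin n → K)}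
    (h : irreducibleDegree W ≠ ⊤) : ∃ r δ : ℕ, affineDim K W = (r : WithBot ℕ∞) ∧
      GeneralSectionCount W r δ ∧ irreducibleDegree W = δ := by
  have hne : {D : ℕ∞ | ∃ r : ℕ, affineDim K W = (r : WithBot ℕ∞) ∧
      GeneralSectionCount W r D}.Nonempty := by
    by_contra hempty
    rw [Set.not_nonempty_iff_eq_empty] at hempty
    rw [irreducibleDegree, hempty, sInf_empty] at h
    exact h rfl
  obtain ⟨r, hr, hcount⟩ := csInf_mem hne
  obtain ⟨δ, hδ⟩ := ENat.ne_top_iff_exists.mp h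
  refine ⟨r, δ, hr, ?_, hδ.symm⟩
  rw [hδ]
  exact hcount

variable [IsAlgClosed K]

theorem trdeg_coordinateRing {W : Set (Fin n → K)} (hW : IsIrreducibleVariety K W)
    (hr : affineDim K W = (r : WithBot ℕ∞)) : Algebra.trdeg K (CoordinateRing K W) = r := by
  have := hW.isPrime
  rw [affineDim_eq_ringKrullDim hW.1] at hr
  exact trdeg_eq_of_ringKrullDim_eq (by exact_mod_cast hr)

theorem exists_relation_of_affineDim_eq {W : Set (Fin n → K)} (hW : IsIrreducibleVariety K W)
    (hr : affineDim K W = (r : WithBot ℕ∞)) (z : Fin (r + 1) → MvPolynomial (Fin n) K) :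
    ∃ T : MvPolynomial (Fin (r + 1)) K, T ≠ 0 ∧ ∀ x ∈ W, eval (fun i => eval x (z i)) T = 0 := by
  have := hW.isPrime
  have hnot : ¬ AlgebraicIndependent K fun i =>
      (Ideal.Quotient.mk (vanishingIdeal K W) (z i) : CoordinateRing K W) := by
    intro hind
    have h1 := hind.lift_cardinalMk_le_trdeg
    rw [trdeg_coordinateRing hW hr] at h1
    simp only [Cardinal.mk_fin, Cardinal.lift_natCast] at h1
    have h2 : r + 1 ≤ r := by exact_mod_cast h1
    omega
  rw [algebraicIndependent_iff] at hnot
  push Not at hnot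
  obtain ⟨T, hT, hT0⟩ := hnot
  exact ⟨T, hT0, (aeval_mk_eq_zero_iff z T).mp hT⟩

/-- The coordinate classes generate the ring, so a transcendence basis can be chosen among them. -/
theorem exists_independent_coordinates {W : Set (Fin n → K)} (hW : IsIrreducibleVariety K W)
    (hr : affineDim K W = (r : WithBot ℕ∞)) :
    ∃ c : Fin r → Fin n, Function.Injective c ∧
      ∀ T : MvPolynomial (Fin r) K, (∀ x ∈ W, eval (fun i => x (c i)) T = 0) → T = 0 := by
  have := hW.isPrime
  let y : Fin n → CoordinateRing K W := fun j => Ideal.Quotient.mk (vanishingIdeal K W) (X j)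
  have htop : Algebra.adjoin K (Set.range y) = ⊤ := by
    have h1 : Set.range y = Set.image (Ideal.Quotient.mkₐ K (vanishingIdeal K W)) (Set.range X) := by
      rw [← Set.range_comp]
      rfl
    rw [h1, ← AlgHom.map_adjoin, MvPolynomial.adjoin_range_X, Algebra.map_top,
      AlgHom.range_eq_top]
    exact Ideal.Quotient.mkₐ_surjective _ _
  have halg : Algebra.IsAlgebraic (Algebra.adjoin K (Set.range y)) (CoordinateRing K W) := by
    refine ⟨fun x => isAlgebraic_algebraMap (⟨x, htop ▸ Algebra.mem_top⟩ :
      Algebra.adjoin K (Set.range y))⟩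
  obtain ⟨t, ht, hbasis⟩ := exists_isTranscendenceBasis_subset (R := K) (Set.range y)
  have hcard := hbasis.cardinalMk_eq_trdeg
  rw [trdeg_coordinateRing hW hr] at hcard
  have : Finite t := (Set.finite_range y).subset ht
  have hcard' : Nat.card t = r := by
    rw [Nat.card, hcard, Cardinal.toNat_natCast]
  let e : Fin r ≃ t := (Finite.equivFinOfCardEq hcard').symm
  have hmem : ∀ i, ∃ j, y j = e i := fun i => ht (e i).2
  choose c hc using hmem
  refine ⟨c, fun i j hij => ?_, fun T hT => ?_⟩
  · apply e.injective
    apply Subtype.ext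
    rw [← hc, ← hc, hij]
  · have hind := hbasis.1.comp e e.injective
    refine algebraicIndependent_iff.mp hind T ?_
    have h1 := (aeval_mk_eq_zero_iff (W := W) (fun i => X (c i)) T).mpr (by simpa using hT)
    rw [← h1]
    congr 2
    funext i
    exact (hc i).symm

theorem satisfyRelation_of_generalSectionCount {W : Set (Fin n → K)}
    (hW : IsIrreducibleVariety K W) (hr : affineDim K W = (r : WithBot ℕ∞)) {δ : ℕ}
    (hδ : GeneralSectionCount W r δ) (A : Matrix (Fin (r + 1)) (Fin n) K) :
    SatisfyRelation W δ A := by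
  classical
  have hinf : Infinite K := IsAlgClosed.instInfinite
  obtain ⟨c, hc, hind⟩ := exists_independent_coordinates hW hr
  obtain ⟨G, hG0, hG⟩ := exists_evalSystem_encard_eq hδ hc
  -- Independence of the coordinates `c` lets a generic system be chosen through a point of `W`, so
  -- its section is not empty.
  have hδ0 : δ ≠ 0 := by
    obtain ⟨A₁, x, hx, hA₁⟩ := exists_mem_evalSystem_ne_zero (W := W)
      (A₀ := fun i => Pi.single (c i) 1) (fun N => by
        rintro ⟨P, hP0, -, hP⟩
        refine hP0 (hind P fun x hx => ?_)
        rw [← hP x hx]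
        congr 2
        funext i
        simp [Matrix.mulVec]) hG0
    rintro rfl
    have h1 := hG _ _ hA₁
    rw [Nat.cast_zero, Set.encard_eq_zero] at h1
    exact (h1 ▸ (⟨hx, rfl⟩ : x ∈ W ∩ {y | A₁.mulVec y = A₁.mulVec x}) : x ∈ (∅ : Set _))
  obtain ⟨A₁, b, hA₁⟩ := exists_evalSystem_ne_zero hG0
  -- Genericity is imposed on all rows but the first.
  have hH : rename (Prod.map Fin.succ id) (fixVector b G) ≠ 0 := by
    intro h0
    rw [map_eq_zero_iff _ (rename_injective _
      ((Fin.succ_injective r).prodMap Function.injective_id))] at h0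
    rw [← eval_fixVector, h0, map_zero] at hA₁
    exact hA₁ rfl
  refine satisfyRelation_of_generic hH (fun A hA => ?_) A
  rw [eval_rename] at hA
  refine satisfyRelation_of_evalSystem_ne_zero hW (exists_relation_of_affineDim_eq hW hr) hδ0 hG
    A b ?_
  have h1 := eval_fixVector (Matrix.of fun i => A i.succ) b G
  exact fun h => hA (h1.trans h)

/-- An irreducible variety of dimension at most `k` satisfies in any `k + 1` coordinates a
polynomial equation of degree at most its degree. -/
theorem exists_vanishing_of_irreducible {W : Set (Fin n → K)} (hW : IsIrreducibleVariety K W)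
    {k : ℕ} (hdim : affineDim K W ≤ (k : WithBot ℕ∞)) (hdeg : irreducibleDegree W ≠ ⊤)
    {J : Finset (Fin n)} (hJ : J.card = k + 1) :
    ∃ g : MvPolynomial (Fin n) K, g ≠ 0 ∧ g.vars ⊆ J ∧ (g.totalDegree : ℕ∞) ≤ irreducibleDegree W ∧
      ∀ x ∈ W, eval x g = 0 := by
  classical
  obtain ⟨r, δ, hr, hcount, hδ⟩ := exists_generalSectionCount_of_irreducibleDegree_ne_top hdeg
  have hrk : r ≤ k := by
    rw [hr] at hdim
    exact_mod_cast hdim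
  let e : Fin (k + 1) ≃ J := (Finset.equivFinOfCardEq hJ).symm
  let c : Fin (r + 1) → Fin n := fun i => e (Fin.castLE (by omega) i)
  have hc : Function.Injective c := fun i j hij =>
    Fin.castLE_injective _ (e.injective (Subtype.ext hij))
  -- Unit row vectors turn the linear forms into coordinates; `r + 1` of the `k + 1` allowed ones
  -- suffice.
  obtain ⟨P, hP0, hPδ, hP⟩ := satisfyRelation_of_generalSectionCount hW hr hcount
    (fun i => Pi.single (c i) 1)
  refine ⟨rename c P, ?_, ?_, ?_, fun x hx => ?_⟩
  · rwa [Ne, map_eq_zero_iff _ (rename_injective _ hc)]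
  · refine (vars_rename _ _).trans fun j hj => ?_
    obtain ⟨i, -, rfl⟩ := Finset.mem_image.mp hj
    exact (e _).2
  · rw [hδ]
    exact_mod_cast (totalDegree_rename_le _ _).trans hPδ
  · rw [eval_rename, ← hP x hx]
    congr 2
    funext i
    simp [Matrix.mulVec]

theorem isIrreducibleComponent_of_mem_minimalPrimes {V : Set (Fin n → K)}
    (hV : IsAffineVariety K V) {P : Ideal (MvPolynomial (Fin n) K)}
    (hP : P ∈ (vanishingIdeal K V).minimalPrimes) :
    IsIrreducibleComponent K V (zeroLocus K P) := by
  have hprime : P.IsPrime := hP.1.1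
  refine ⟨⟨isIrreducibleVariety_zeroLocus P, ?_⟩, fun W hW hPW => ?_⟩
  · conv_rhs => rw [← isAffineVariety_iff.mp hV]
    exact zeroLocus_anti_mono hP.1.2
  · have h1 : vanishingIdeal K W ≤ P := by
      conv_rhs => rw [← IsPrime.vanishingIdeal_zeroLocus (K := K) P]
      exact vanishingIdeal_anti_mono hPW
    have h2 := hP.2 ⟨hW.1.isPrime, vanishingIdeal_anti_mono hW.2⟩ h1
    conv_lhs => rw [← isAffineVariety_iff.mp hW.1.1]
    exact zeroLocus_anti_mono h2

/-- The variety is covered by finitely many irreducible components. -/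
theorem exists_finset_components {V : Set (Fin n → K)} (hV : IsAffineVariety K V) :
    ∃ s : Finset {W : Set (Fin n → K) // IsIrreducibleComponent K V W},
      ∀ x ∈ V, ∃ W ∈ s, x ∈ W.1 := by
  classical
  have hfin := Ideal.finite_minimalPrimes_of_isNoetherianRing _ (vanishingIdeal K V)
  refine ⟨hfin.toFinset.attach.image fun P => ⟨zeroLocus K P.1,
    isIrreducibleComponent_of_mem_minimalPrimes hV (hfin.mem_toFinset.mp P.2)⟩, fun x hx => ?_⟩
  have hle : vanishingIdeal K V ≤ vanishingIdeal K {x} :=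
    vanishingIdeal_anti_mono (Set.singleton_subset_iff.mpr hx)
  obtain ⟨P, hP, hPx⟩ := Ideal.exists_minimalPrimes_le hle
  refine ⟨_, Finset.mem_image.mpr ⟨⟨P, hfin.mem_toFinset.mpr hP⟩, Finset.mem_attach _ _, rfl⟩, ?_⟩
  exact fun p hp => hPx hp x rfl

/-- A variety of dimension at most `k` and degree at most `d` satisfies in any `k + 1` coordinates
a polynomial equation of degree at most `d`. -/
theorem exists_vanishing {F : Type*} [Field F] [Algebra F K] [Algebra.IsAlgebraic F K]
    {V : Set (Fin n → K)} (hV : IsAffineVariety F V) {k d : ℕ}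
    (hdim : affineDim F V ≤ (k : WithBot ℕ∞)) (hdeg : affineDegree V ≤ (d : ℕ∞))
    {J : Finset (Fin n)} (hJ : J.card = k + 1) :
    ∃ g : MvPolynomial (Fin n) K, g ≠ 0 ∧ g.vars ⊆ J ∧ g.totalDegree ≤ d ∧
      ∀ x ∈ V, eval x g = 0 := by
  classical
  obtain ⟨s, hs⟩ := exists_finset_components hV.baseChange
  have hsum : ∑ W ∈ s, irreducibleDegree W.1 ≤ (d : ℕ∞) :=
    (le_iSup (fun s : Finset {W : Set (Fin n → K) // IsIrreducibleComponent K V W} =>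
      ∑ W ∈ s, irreducibleDegree W.1) s).trans hdeg
  have hne : ∀ W ∈ s, irreducibleDegree W.1 ≠ ⊤ := fun W hW =>
    ne_top_of_le_ne_top (ENat.natCast_ne_top d) ((Finset.single_le_sum (fun _ _ => zero_le) hW).trans
      hsum)
  have hex : ∀ W ∈ s, ∃ g : MvPolynomial (Fin n) K, g ≠ 0 ∧ g.vars ⊆ J ∧
      (g.totalDegree : ℕ∞) ≤ irreducibleDegree W.1 ∧ ∀ x ∈ W.1, eval x g = 0 := fun W hW =>
    exists_vanishing_of_irreducible W.2.1.1
      ((affineDim_le_affineDim hV W.2.1.2).trans hdim) (hne W hW) hJ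
  choose! g hg0 hgJ hgd hg using hex
  -- In the product the degrees add up to at most the sum of the degrees of the components.
  refine ⟨∏ W ∈ s, g W, Finset.prod_ne_zero_iff.mpr hg0, ?_, ?_, fun x hx => ?_⟩
  · refine (vars_prod _).trans (Finset.biUnion_subset.mpr hgJ)
  · refine (totalDegree_finsetProd _ _).trans ?_
    have h1 : ((∑ W ∈ s, (g W).totalDegree : ℕ) : ℕ∞) ≤ d := by
      rw [Nat.cast_sum]
      exact (Finset.sum_le_sum hgd).trans hsum
    exact_mod_cast h1
  · obtain ⟨W, hW, hxW⟩ := hs x hx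
    rw [map_prod]
    exact Finset.prod_eq_zero hW (hg W hW x hxW)

end Degree

/-! ### Valuations and integrality -/

section Integrality

/-- The valuative criterion of integrality. -/
theorem isIntegral_of_forall_valuationSubring {B S : Type*} {T : Type*} [CommRing B] [CommRing S]
    [CommRing T] [Algebra B S] (ι : S →+* T) (hι : Function.Injective ι) (x : S)
    (h : ∀ (Q : Ideal T) [Q.IsPrime] (O : ValuationSubring (FractionRing (T ⧸ Q))),
      (∀ b : B, algebraMap (T ⧸ Q) _ (Ideal.Quotient.mk Q (ι (algebraMap B S b))) ∈ O) →
        algebraMap (T ⧸ Q) _ (Ideal.Quotient.mk Q (ι x)) ∈ O) : IsIntegral B x := by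
  by_contra hx
  -- If `x` is not integral, this multiplicative set of values of monic polynomials omits 0. A prime
  -- `Q` disjoint from it keeps `x` non-integral modulo `Q`, where integral closure is an
  -- intersection of valuation rings.
  let M : Submonoid T :=
    { carrier := {t | ∃ p : Polynomial B, p.Monic ∧ t = ι (Polynomial.aeval x p)}
      one_mem' := ⟨1, Polynomial.monic_one, by simp⟩
      mul_mem' := by
        rintro _ _ ⟨p, hp, rfl⟩ ⟨q, hq, rfl⟩
        exact ⟨p * q, hp.mul hq, by simp⟩ }
  have hdisj : Disjoint ((⊥ : Ideal T) : Set T) M := by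
    rw [Set.disjoint_left]
    rintro t ht ⟨p, hp, hpt⟩
    have ht0 : t = 0 := ht
    rw [ht0] at hpt
    exact hx ⟨p, hp, hι (by rw [map_zero]; exact hpt.symm)⟩
  obtain ⟨Q, hQ, -, hQM⟩ := Ideal.exists_le_prime_disjoint _ M hdisj
  let L := FractionRing (T ⧸ Q)
  let θ : S →+* L := (algebraMap (T ⧸ Q) L).comp ((Ideal.Quotient.mk Q).comp ι)
  let τ : B →+* L := θ.comp (algebraMap B S)
  have hnot : θ x ∉ (integralClosure (Subring.closure (Set.range τ)) L).toSubring := by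
    rintro ⟨p, hp, hpx⟩
    have hrange : Subring.closure (Set.range τ) = τ.range := by
      rw [← RingHom.coe_range, Subring.closure_eq]
    have hmem : ∀ b, τ b ∈ Subring.closure (Set.range τ) := fun b =>
      Subring.subset_closure ⟨b, rfl⟩
    let f : B →+* Subring.closure (Set.range τ) := τ.codRestrict _ hmem
    have hf : Function.Surjective f := by
      rintro ⟨y, hy⟩
      have hy' := hy
      rw [hrange] at hy'
      obtain ⟨b, rfl⟩ := hy'
      exact ⟨b, rfl⟩
    obtain ⟨q, hqp, -, hq⟩ := Polynomial.lifts_and_natDegree_eq_and_monic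
      ((Polynomial.mem_lifts _).mpr (Polynomial.map_surjective f hf p)) hp
    have h1 : θ (Polynomial.aeval x q) = 0 := by
      rw [← hqp, Polynomial.eval₂_map] at hpx
      rw [Polynomial.aeval_def, Polynomial.hom_eval₂]
      exact hpx
    have h2 : ι (Polynomial.aeval x q) ∈ Q := by
      have h3 : algebraMap (T ⧸ Q) L (Ideal.Quotient.mk Q (ι (Polynomial.aeval x q))) = 0 := h1
      rw [map_eq_zero_iff _ (IsFractionRing.injective (T ⧸ Q) L)] at h3
      exact Ideal.Quotient.eq_zero_iff_mem.mp h3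
    exact Set.disjoint_left.mp hQM h2 ⟨q, hq, rfl⟩
  apply hnot
  rw [← iInf_valuationSubring_superset, Subring.mem_iInf]
  rintro ⟨O, hO⟩
  exact h Q O fun b => hO ⟨b, rfl⟩

/-- Coefficients extracting one of finitely many linearly independent columns. -/
theorem exists_coeff_of_linearIndependent {F ι : Type*} [Field F] {m : ℕ} {c : ι → Fin m → F}
    (hc : LinearIndependent F c) (s : ι) :
    ∃ l : Fin m → F, ∑ i, l i * c s i = 1 ∧ ∀ j, j ≠ s → ∑ i, l i * c j i = 0 := by
  classical
  obtain ⟨φ, hφ⟩ := LinearMap.exists_extend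
    ((Finsupp.lapply s : (ι →₀ F) →ₗ[F] F) ∘ₗ hc.repr)
  have hval : ∀ j, φ (c j) = if j = s then 1 else 0 := by
    intro j
    have h1 := LinearMap.congr_fun hφ ⟨c j, Submodule.subset_span ⟨j, rfl⟩⟩
    simp only [LinearMap.comp_apply, Submodule.subtype_apply] at h1
    rw [h1]
    have h2 := hc.repr_eq_single j ⟨c j, Submodule.subset_span ⟨j, rfl⟩⟩ rfl
    simp [h2, Finsupp.single_apply]
  refine ⟨fun i => φ fun t => if i = t then 1 else 0, ?_, fun j hj => ?_⟩
  · have h1 := LinearMap.pi_apply_eq_sum_univ φ (c s)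
    rw [hval, if_pos rfl] at h1
    simpa [mul_comm] using h1.symm
  · have h1 := LinearMap.pi_apply_eq_sum_univ φ (c j)
    rw [hval, if_neg hj] at h1
    simpa [mul_comm] using h1.symm

/-- The weights `∏_{i ≠ j} eᵢ` separate the exponent vectors bounded by pairwise coprime `eⱼ`. -/
theorem eq_of_sum_mul_prod_erase_eq {n : ℕ} {e : Fin n → ℕ}
    (hcop : Pairwise fun i j => Nat.Coprime (e i) (e j)) {a b : Fin n → ℕ}
    (ha : ∀ j, a j < e j) (hb : ∀ j, b j < e j)
    (h : ∑ j, a j * ∏ i ∈ Finset.univ.erase j, e i = ∑ j, b j * ∏ i ∈ Finset.univ.erase j, e i) :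
    a = b := by
  funext j
  -- Modulo `e j` only the `j`-th term survives, and its cofactor is invertible by coprimality.
  have key : ∀ a : Fin n → ℕ, (∑ l, a l * ∏ i ∈ Finset.univ.erase l, e i) ≡
      a j * ∏ i ∈ Finset.univ.erase j, e i [MOD e j] := by
    intro a
    rw [← Finset.add_sum_erase _ _ (Finset.mem_univ j)]
    conv_rhs => rw [← add_zero (a j * _)]
    refine Nat.ModEq.add_left _ ((Nat.modEq_zero_iff_dvd).mpr (Finset.dvd_sum fun l hl => ?_))
    refine Dvd.dvd.mul_left (Finset.dvd_prod_of_mem e ?_) _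
    exact Finset.mem_erase.mpr ⟨(Finset.ne_of_mem_erase hl).symm, Finset.mem_univ _⟩
  have h1 : a j * ∏ i ∈ Finset.univ.erase j, e i ≡ b j * ∏ i ∈ Finset.univ.erase j, e i
      [MOD e j] := (key a).symm.trans ((congrArg (· % e j) h : _ ≡ _ [MOD e j]).trans (key b))
  have h2 : Nat.gcd (e j) (∏ i ∈ Finset.univ.erase j, e i) = 1 :=
    Nat.Coprime.prod_right fun i hi => hcop (Finset.ne_of_mem_erase hi).symm
  exact (Nat.ModEq.cancel_right_of_coprime h2 h1).eq_of_lt_of_lt (ha j) (hb j)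

/-- If the forms `∑ⱼ cᵢⱼ xⱼ ^ eⱼ` and all constants are integral for a valuation, and any `k + 1`
of the `xⱼ` satisfy an equation whose exponents are less than the `eⱼ`, then the `xⱼ` are integral
for the valuation. -/
theorem mem_valuationSubring_of_relations {F K L : Type*} [Field F] [Field K] [Field L]
    [Algebra F K] {n m k : ℕ} (hk : k ≤ n) (ψ : K →+* L) (O : ValuationSubring L)
    (hψ : ∀ c, ψ c ∈ O) {e : Fin n → ℕ} (he : ∀ j, e j ≠ 0)
    (hcop : Pairwise fun i j => Nat.Coprime (e i) (e j)) {M : Matrix (Fin m) (Fin n) F}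
    (hM : IsRegularMatrix k M) (x : Fin n → L)
    (hf : ∀ i, ∑ j, ψ (algebraMap F K (M i j)) * x j ^ e j ∈ O)
    (hg : ∀ J : Finset (Fin n), J.card = k + 1 → ∃ g : MvPolynomial (Fin n) K, g ≠ 0 ∧
      g.vars ⊆ J ∧ (∀ α ∈ g.support, ∀ j, α j < e j) ∧ eval₂ ψ x g = 0) (j₀ : Fin n) :
    x j₀ ∈ O := by
  classical
  by_contra hj₀
  let v := O.valuation
  have hvψ : ∀ c, v (ψ c) ≤ 1 := fun c => (O.valuation_le_one_iff _).mpr (hψ c)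
  have hvψ1 : ∀ c, c ≠ 0 → v (ψ c) = 1 := by
    intro c hc
    refine le_antisymm (hvψ c) ?_
    have h1 : v (ψ c) * v (ψ c⁻¹) = 1 := by
      rw [← map_mul, ← map_mul, mul_inv_cancel₀ hc, map_one, map_one]
    calc 1 = v (ψ c) * v (ψ c⁻¹) := h1.symm
      _ ≤ v (ψ c) * 1 := by gcongr; exact hvψ _
      _ = v (ψ c) := mul_one _
  obtain ⟨t, -, ht⟩ := Finset.exists_max_image Finset.univ (fun j => v (x j) ^ e j)
    ⟨j₀, Finset.mem_univ _⟩
  set γ := v (x t) ^ e t with hγdef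
  have hγ : 1 < γ := by
    refine lt_of_lt_of_le ?_ (ht j₀ (Finset.mem_univ _))
    refine one_lt_pow₀ ?_ (he j₀)
    rw [← not_le, O.valuation_le_one_iff]
    exact hj₀
  let S := Finset.univ.filter fun j => v (x j) ^ e j = γ
  have htS : t ∈ S := by simp [S, hγdef]
  rcases le_or_gt S.card k with hSk | hSk
  -- Regularity speaks of exactly `k` columns, so `S` is enlarged to size `k`. The coefficients `l`
  -- kill every index of `S'` but `t`; indices outside `S'` have value below `γ`.
  · obtain ⟨S', hSS', -, hS'⟩ := Finset.exists_subsuperset_card_eq (Finset.subset_univ S) hSk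
      (by simpa using hk)
    obtain ⟨l, hl1, hl0⟩ := exists_coeff_of_linearIndependent (hM S' hS') ⟨t, hSS' htS⟩
    let μ : Fin n → F := fun j => ∑ i, l i * M i j
    have hcomb : ∑ i, ψ (algebraMap F K (l i)) * ∑ j, ψ (algebraMap F K (M i j)) * x j ^ e j =
        ∑ j, ψ (algebraMap F K (μ j)) * x j ^ e j := by
      simp only [Finset.mul_sum, μ, map_sum, map_mul, Finset.sum_mul]
      rw [Finset.sum_comm]
      exact Finset.sum_congr rfl fun j _ => Finset.sum_congr rfl fun i _ => by ring
    have hle : v (∑ j, ψ (algebraMap F K (μ j)) * x j ^ e j) ≤ 1 := by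
      rw [← hcomb, O.valuation_le_one_iff]
      exact sum_mem fun i _ => mul_mem (hψ _) (hf i)
    rw [← Finset.add_sum_erase _ _ (Finset.mem_univ t)] at hle
    have hμt : μ t = 1 := hl1
    rw [hμt, map_one, map_one, one_mul] at hle
    have hrest : v (∑ j ∈ Finset.univ.erase t, ψ (algebraMap F K (μ j)) * x j ^ e j) < γ := by
      refine v.map_sum_lt' (zero_lt_one.trans hγ) fun j hj => ?_
      by_cases hjS' : j ∈ S'
      · have : μ j = 0 := hl0 ⟨j, hjS'⟩ fun h => (Finset.ne_of_mem_erase hj) (congrArg Subtype.val h)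
        rw [this]
        simpa using zero_lt_one.trans hγ
      · have hjS : v (x j) ^ e j ≠ γ := fun h => hjS' (hSS' (by simp [S, h]))
        rw [map_mul, map_pow]
        calc v (ψ (algebraMap F K (μ j))) * v (x j) ^ e j ≤ 1 * v (x j) ^ e j := by
              gcongr; exact hvψ _
          _ = v (x j) ^ e j := one_mul _
          _ < γ := lt_of_le_of_ne (ht j (Finset.mem_univ _)) hjS
    have h3 := v.map_sub_lt (hle.trans_lt hγ) hrest
    rw [add_sub_cancel_right, map_pow] at h3
    exact lt_irrefl _ h3
  · obtain ⟨J, hJS, hJ⟩ := Finset.exists_subset_card_eq (Nat.succ_le_of_lt hSk)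
    obtain ⟨g, hg0, hgJ, hge, hgx⟩ := hg J hJ
    let N : (Fin n →₀ ℕ) → ℕ := fun α => ∑ j, α j * ∏ i ∈ Finset.univ.erase j, e i
    have hD : (∏ i, e i) ≠ 0 := Finset.prod_ne_zero_iff.mpr fun i _ => he i
    -- Formally `v (x j)` is `γ ^ (1 / e j)` on `J`. Raising to the power `∏ e i` clears these roots
    -- and gives monomials the integer weights `N`.
    have hvpow : ∀ α ∈ g.support, (∏ j, v (x j) ^ α j) ^ (∏ i, e i) = γ ^ N α := by
      intro α hα
      rw [← Finset.prod_pow, ← Finset.prod_pow_eq_pow_sum]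
      refine Finset.prod_congr rfl fun j _ => ?_
      by_cases hj : α j = 0
      · simp [hj]
      · have hjS : j ∈ S := hJS (hgJ ((mem_vars_iff_mem_support j).mpr
          ⟨α, hα, Finsupp.mem_support_iff.mpr hj⟩))
        have hjγ : v (x j) ^ e j = γ := (Finset.mem_filter.mp hjS).2
        rw [← hjγ, ← pow_mul, ← pow_mul, ← Finset.mul_prod_erase _ _ (Finset.mem_univ j)]
        congr 1
        ring
    obtain ⟨α₀, hα₀, hmax⟩ := Finset.exists_max_image g.support N
      (Finset.nonempty_of_ne_empty fun h => hg0 (support_eq_empty.mp h))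
    have hlt : ∀ β ∈ g.support.erase α₀, v (ψ (coeff β g) * ∏ j, x j ^ β j) <
        ∏ j, v (x j) ^ α₀ j := by
      intro β hβ
      have hβg := Finset.mem_of_mem_erase hβ
      rw [map_mul, map_prod, hvψ1 _ (mem_support_iff.mp hβg), one_mul]
      simp only [map_pow]
      refine lt_of_pow_lt_pow_left₀ (∏ i, e i) zero_le ?_
      rw [hvpow β hβg, hvpow α₀ hα₀]
      refine pow_lt_pow_right₀ hγ (lt_of_le_of_ne (hmax β hβg) fun h => ?_)
      exact Finset.ne_of_mem_erase hβ (DFunLike.coe_injective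
        (eq_of_sum_mul_prod_erase_eq hcop (hge β hβg) (hge α₀ hα₀) h))
    have hpos : 0 < ∏ j, v (x j) ^ α₀ j := by
      rw [pos_iff_ne_zero]
      intro h0
      have h1 := hvpow α₀ hα₀
      rw [h0, zero_pow hD] at h1
      exact (pow_pos (zero_lt_one.trans hγ) _).ne h1
    rw [eval₂_eq', ← Finset.add_sum_erase _ _ hα₀] at hgx
    have h1 := v.map_sum_lt' hpos hlt
    rw [← neg_eq_of_add_eq_zero_right hgx, v.map_neg, map_mul, map_prod,
      hvψ1 _ (mem_support_iff.mp hα₀), one_mul] at h1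
    simp only [map_pow] at h1
    exact lt_irrefl _ h1

end Integrality

/-! ### Finiteness of the restricted map -/

section Finiteness

variable {F K : Type*} [Field F] [Field K] [Algebra F K] {n m k d : ℕ}

/-- Elements of `K` are integral over `F`, and valuation rings are integrally closed. -/
theorem mem_valuationSubring_of_isAlgebraic [Algebra.IsAlgebraic F K] {L : Type*} [Field L]
    (ψ : K →+* L) (O : ValuationSubring L) (h : ∀ c : F, ψ (algebraMap F K c) ∈ O) (c : K) :
    ψ c ∈ O := by
  let ρ : F →+* O := (ψ.comp (algebraMap F K)).codRestrict O h
  obtain ⟨p, hp, hpc⟩ := Algebra.IsIntegral.isIntegral (R := F) c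
  have hint : IsIntegral O (ψ c) := by
    refine ⟨p.map ρ, hp.map ρ, ?_⟩
    rw [Polynomial.eval₂_map]
    have h1 := congrArg ψ hpc
    rw [Polynomial.hom_eval₂, map_zero] at h1
    exact h1
  obtain ⟨y, hy⟩ := IsIntegrallyClosed.algebraMap_eq_of_integral hint
  rw [← hy]
  exact y.2

/-- The inclusion `F[V] → K[V]`. -/
noncomputable def coordinateRingMap (F : Type*) {K : Type*} [Field F] [Field K] [Algebra F K]
    (V : Set (Fin n → K)) : CoordinateRing F V →+* CoordinateRing K V :=
  Ideal.quotientMap (vanishingIdeal K V) (MvPolynomial.map (algebraMap F K)) fun p hp x hx => by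
    rw [aeval_map_algebraMap]
    exact hp x hx

theorem coordinateRingMap_injective (V : Set (Fin n → K)) :
    Function.Injective (coordinateRingMap F V) := by
  refine Ideal.quotientMap_injective' fun p hp x hx => ?_
  have h1 := hp x hx
  rwa [aeval_map_algebraMap] at h1

theorem coordinateRingMap_mk (V : Set (Fin n → K)) (p : MvPolynomial (Fin n) F) :
    coordinateRingMap F V (Ideal.Quotient.mk _ p) =
      Ideal.Quotient.mk _ (MvPolynomial.map (algebraMap F K) p) :=
  Ideal.quotientMap_mk

/-- Finiteness of the restriction of the map `f_i = ∑ⱼ cᵢⱼ Xⱼ ^ eⱼ`. -/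
theorem restrictsToFinite_dklPoly [IsAlgClosed K] [Algebra.IsAlgebraic F K] (hk : k ≤ n)
    {e : Fin n → ℕ} (he : ∀ j, d < e j) (hcop : Pairwise fun i j => Nat.Coprime (e i) (e j))
    {M : Matrix (Fin m) (Fin n) F} (hM : IsRegularMatrix k M) {V : Set (Fin n → K)}
    (hV : IsAffineVariety F V) (hdim : affineDim F V ≤ (k : WithBot ℕ∞))
    (hdeg : affineDegree V ≤ (d : ℕ∞)) : RestrictsToFinite (dklPoly M e) V := by
  let I := vanishingIdeal F V
  let B := (comorphism (dklPoly M e) (V := V) (V' := Set.univ)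
    (Set.mapsTo_univ (polyMap K (dklPoly M e)) V)).range
  change Module.Finite B (CoordinateRing F V)
  have hmemB : ∀ i, Ideal.Quotient.mk I (dklPoly M e i) ∈ B := fun i =>
    ⟨Ideal.Quotient.mk _ (X i), by
      change Ideal.Quotient.mk I (aeval (dklPoly M e) (X i)) = _
      rw [aeval_X]⟩
  have hX : ∀ j, IsIntegral B (Ideal.Quotient.mk I (X j) : CoordinateRing F V) := by
    intro j
    -- The valuations are taken on quotients of `K[V]` because the equations supplied by the degree
    -- have coefficients in `K`.
    refine isIntegral_of_forall_valuationSubring (coordinateRingMap F V)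
      (coordinateRingMap_injective V) _ fun Q hQ O hO => ?_
    let θ : MvPolynomial (Fin n) K →+* FractionRing (CoordinateRing K V ⧸ Q) :=
      (algebraMap _ _).comp ((Ideal.Quotient.mk Q).comp (Ideal.Quotient.mk (vanishingIdeal K V)))
    have hOB : ∀ p : MvPolynomial (Fin n) F, Ideal.Quotient.mk I p ∈ B →
        θ (MvPolynomial.map (algebraMap F K) p) ∈ O := fun p hp => by
      have h1 := hO ⟨_, hp⟩
      change algebraMap _ _ (Ideal.Quotient.mk Q (coordinateRingMap F V
        (Ideal.Quotient.mk I p))) ∈ O at h1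
      rw [coordinateRingMap_mk] at h1
      exact h1
    have hθ : ∀ p, θ p = eval₂Hom (θ.comp C) (fun j => θ (X j)) p :=
      RingHom.congr_fun (MvPolynomial.ringHom_ext (by simp) (by simp))
    rw [coordinateRingMap_mk, map_X]
    refine mem_valuationSubring_of_relations hk (θ.comp C) O
      (mem_valuationSubring_of_isAlgebraic (F := F) _ O fun c => ?_)
      (fun j => (Nat.zero_lt_of_lt (he j)).ne')
      hcop hM (fun j => θ (X j)) (fun i => ?_) (fun J hJ => ?_) j
    · have h1 := hOB (C c) (B.algebraMap_mem c)
      rwa [map_C] at h1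
    · have h1 := hOB _ (hmemB i)
      simpa [dklPoly] using h1
    · obtain ⟨g, hg0, hgJ, hgd, hg⟩ := exists_vanishing hV hdim hdeg hJ
      refine ⟨g, hg0, hgJ, fun α hα j => ?_, ?_⟩
      · refine lt_of_le_of_lt ?_ (he j)
        exact (Finsupp.le_degree j α).trans ((le_totalDegree hα).trans hgd)
      · refine (hθ g).symm.trans ?_
        have h1 : g ∈ vanishingIdeal K V := fun x hx => by
          rw [← hg x hx, ← coe_aeval_eq_eval]
          rfl
        change algebraMap _ _ (Ideal.Quotient.mk Q (Ideal.Quotient.mk (vanishingIdeal K V) g)) = 0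
        rw [Ideal.Quotient.eq_zero_iff_mem.mpr h1, map_zero, map_zero]
  have hint : Algebra.IsIntegral B (CoordinateRing F V) := by
    refine ⟨fun z => ?_⟩
    obtain ⟨p, rfl⟩ := Ideal.Quotient.mk_surjective z
    induction p using MvPolynomial.induction_on with
    | C c =>
      exact isIntegral_algebraMap (R := B) (x := algebraMap F B c)
    | add p q hp hq => rw [map_add]; exact hp.add hq
    | mul_X p j hp => rw [map_mul]; exact hp.mul (hX j)
  have hft : Algebra.FiniteType B (CoordinateRing F V) :=
    Algebra.FiniteType.of_restrictScalars_finiteType F B (CoordinateRing F V)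
  have hfin := Algebra.IsIntegral.finite (R := B) (A := CoordinateRing F V)
  exact hfin

end Finiteness

/-! ### Vandermonde matrices and prime exponents -/

section Universal

theorem isRegularMatrix_vandermondeMatrix {F : Type*} [Field F] {n : ℕ} (k : ℕ) {ω : Fin n → F}
    (hω : Function.Injective ω) : IsRegularMatrix k (vandermondeMatrix k ω) := by
  intro J hJ
  let e : Fin k ≃ J := (Finset.equivFinOfCardEq hJ).symm
  have hdet : (Matrix.vandermonde fun i => ω (e i)).det ≠ 0 :=
    Matrix.det_vandermonde_ne_zero_iff.mpr fun i j h => e.injective (Subtype.ext (hω h))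
  have hli : LinearIndependent F (Matrix.vandermonde fun i => ω (e i)).row :=
    Matrix.linearIndependent_rows_of_det_ne_zero hdet
  rw [← linearIndependent_equiv e]
  exact hli

theorem totalDegree_dklPoly_le {F : Type*} [Field F] {n m : ℕ} (M : Matrix (Fin m) (Fin n) F)
    {e : Fin n → ℕ} {N : ℕ} (he : ∀ j, e j ≤ N) (i : Fin m) : (dklPoly M e i).totalDegree ≤ N := by
  refine totalDegree_finsetSum_le fun j _ => (totalDegree_mul _ _).trans ?_
  rw [totalDegree_C, zero_add, totalDegree_X_pow]
  exact he j

/-- There are `n` primes greater than `d` and of size `O((n + d) log (n + d))`. -/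
theorem exists_primes_le : ∃ C : ℝ, 0 < C ∧ ∀ n d : ℕ, 1 ≤ n → 1 ≤ d →
    ∃ e : Fin n → ℕ, (∀ j, d < e j) ∧ (∀ j, (e j).Prime) ∧ Function.Injective e ∧
      ∀ j, (e j : ℝ) ≤ C * ((n + d : ℝ) * Real.log (n + d)) := by
  refine ⟨32, by norm_num, fun n d hn hd => ?_⟩
  have hprime : ∀ i, (Nat.nth Nat.Prime i).Prime := Nat.prime_nth_prime
  have hmono : StrictMono (Nat.nth Nat.Prime) := Nat.nth_strictMono Nat.infinite_setOfPred_prime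
  -- With indices starting at 0, the prime of index `d + j` is at least `d + j + 2`.
  refine ⟨fun j => Nat.nth Nat.Prime (d + j), fun j => ?_, fun j => hprime _,
    fun i j hij => ?_, fun j => ?_⟩
  · have h1 := Nat.add_two_le_nth_prime (d + j)
    change d < Nat.nth Nat.Prime (d + j)
    omega
  · have h1 := hmono.injective hij
    exact Fin.ext (by omega)
  · set s := n + d with hs
    set q := Nat.nth Nat.Prime (s - 1) with hq
    have hjq : Nat.nth Nat.Prime (d + j) ≤ q := hmono.monotone (by omega)
    have hq2 : 2 ≤ q := (hprime _).two_le
    have hpi : Nat.primeCounting q = s := by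
      rw [Nat.primeCounting, Nat.primeCounting', Nat.count_nth_succ_of_infinite
        Nat.infinite_setOfPred_prime]
      omega
    have hqR : (2 : ℝ) ≤ q := by exact_mod_cast hq2
    have hsR : (2 : ℝ) ≤ s := by
      have : 2 ≤ s := by omega
      exact_mod_cast this
    have hlogq : 0 < Real.log q := Real.log_pos (by linarith)
    have hlog2 : (1 / 2 : ℝ) ≤ Real.log 2 := by linarith [Real.log_two_gt_d9]
    have hlog2s : Real.log 2 ≤ Real.log s := Real.log_le_log (by norm_num) hsR
    -- Chebyshev's lower bound for π gives q ≤ 4 s log q. The crude log q ≤ 2√q yields q ≤ 64 s²,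
    -- hence log q ≤ 8 log s; substituting back gives the constant 32 = 4 · 8.
    have hge := Chebyshev.pi_ge q
    rw [hpi, div_le_iff₀ hlogq] at hge
    have hq1 : Real.log (q + 1) ≤ 2 * Real.log q := by
      have h1 : Real.log ((q : ℝ) ^ 2) = 2 * Real.log q := by
        rw [Real.log_pow]; norm_num
      rw [← h1]
      exact Real.log_le_log (by linarith) (by nlinarith)
    have hmain : (q : ℝ) * Real.log 2 ≤ 2 * s * Real.log q := by nlinarith
    have hqs : (q : ℝ) ≤ 4 * s * Real.log q := by nlinarith
    have hsqrt : 0 < √(q : ℝ) := Real.sqrt_pos.mpr (by linarith)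
    have hsq : √(q : ℝ) * √(q : ℝ) = q := Real.mul_self_sqrt (by linarith)
    have hlogsqrt : Real.log q ≤ 2 * √(q : ℝ) := by
      have h1 : Real.log q = 2 * Real.log (√(q : ℝ)) := by
        rw [Real.log_sqrt (by linarith)]; ring
      rw [h1]
      linarith [Real.log_le_self hsqrt.le]
    have hroot : √(q : ℝ) ≤ 8 * s := by
      by_contra! h
      nlinarith
    have hq64 : (q : ℝ) ≤ 64 * s ^ 2 := by nlinarith
    have hlogq8 : Real.log q ≤ 8 * Real.log s := by
      have h1 : Real.log (2 ^ 6 * (s : ℝ) ^ 2) = 6 * Real.log 2 + 2 * Real.log s := by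
        rw [Real.log_mul (by positivity) (by positivity), Real.log_pow, Real.log_pow]
        norm_num
      have h2 := Real.log_le_log (by linarith) (show (q : ℝ) ≤ 2 ^ 6 * (s : ℝ) ^ 2 by
        linarith)
      linarith
    have hfinal : (q : ℝ) ≤ 32 * (s * Real.log s) := by nlinarith
    have hcast : ((n : ℝ) + d) = s := by rw [hs]; push_cast; ring
    rw [hcast]
    exact le_trans (by exact_mod_cast hjq) hfinal

end Universal

end ExplicitNoether

theorem mainTheorem4 :
    -- finiteness of the restricted map, for every choice of the exponents and of the matrix
    (∀ (F : Type*) [Field F] (n d m k : ℕ), 1 ≤ n → 1 ≤ d → 1 ≤ m → m ≤ n → 1 ≤ k → k ≤ n →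
      ∀ e : Fin n → ℕ, (∀ j, d < e j) → Pairwise (fun i j => Nat.Coprime (e i) (e j)) →
      ∀ M : Matrix (Fin m) (Fin n) F, ExplicitNoether.IsRegularMatrix k M →
      ∀ V : Set (Fin n → AlgebraicClosure F), ExplicitNoether.IsAffineVariety F V →
        ExplicitNoether.affineDim F V ≤ (k : WithBot ℕ∞) →
        ExplicitNoether.affineDegree V ≤ (d : ℕ∞) →
        ExplicitNoether.RestrictsToFinite (ExplicitNoether.dklPoly M e) V) ∧
    -- a universal map `𝔸ⁿ → 𝔸ᵏ` of degree `O((n + d) log (n + d))`, whenever `F` has `n` distinct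
    -- elements `ω`, given by the Vandermonde matrix of `ω`
    (∃ C : ℝ, 0 < C ∧ ∀ n d : ℕ, 1 ≤ n → 1 ≤ d →
      ∃ e : Fin n → ℕ, (∀ j, d < e j) ∧ Pairwise (fun i j => Nat.Coprime (e i) (e j)) ∧
        ∀ (F : Type*) [Field F] (k : ℕ), 1 ≤ k → k ≤ n →
        ∀ ω : Fin n → F, Function.Injective ω →
          ExplicitNoether.IsRegularMatrix k (ExplicitNoether.vandermondeMatrix k ω) ∧
          (∀ i, ((ExplicitNoether.dklPoly (ExplicitNoether.vandermondeMatrix k ω) e i).totalDegree : ℝ)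
            ≤ C * ((n + d : ℝ) * Real.log (n + d))) ∧
          ∀ V : Set (Fin n → AlgebraicClosure F), ExplicitNoether.IsAffineVariety F V →
            ExplicitNoether.affineDim F V ≤ (k : WithBot ℕ∞) →
            ExplicitNoether.affineDegree V ≤ (d : ℕ∞) →
            ExplicitNoether.RestrictsToFinite
              (ExplicitNoether.dklPoly (ExplicitNoether.vandermondeMatrix k ω) e) V) := by
  refine ⟨?_, ?_⟩
  · intro F _ n d m k _ _ _ _ _ hk e he hcop M hM V hV hdim hdeg
    exact ExplicitNoether.restrictsToFinite_dklPoly hk he hcop hM hV hdim hdeg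
  · obtain ⟨C, hC, h⟩ := ExplicitNoether.exists_primes_le
    refine ⟨C, hC, fun n d hn hd => ?_⟩
    obtain ⟨e, he, hprime, hinj, hle⟩ := h n d hn hd
    have hcop : Pairwise fun i j => Nat.Coprime (e i) (e j) := fun i j hij =>
      (Nat.coprime_primes (hprime i) (hprime j)).mpr (hinj.ne hij)
    refine ⟨e, he, hcop, fun F _ k _ hk ω hω => ?_⟩
    have hreg := ExplicitNoether.isRegularMatrix_vandermondeMatrix k hω
    refine ⟨hreg, fun i => ?_, fun V hV hdim hdeg =>
      ExplicitNoether.restrictsToFinite_dklPoly hk he hcop hreg hV hdim hdeg⟩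
    -- The real bound passes through its floor; it is nonnegative since it dominates the exponent at
    -- index 0, which exists as `1 ≤ n`.
    have hbound := ExplicitNoether.totalDegree_dklPoly_le
      (ExplicitNoether.vandermondeMatrix k ω) (N := ⌊C * ((n + d : ℝ) * Real.log (n + d))⌋₊)
      (fun j => Nat.le_floor (hle j)) i
    refine (Nat.cast_le.mpr hbound).trans (Nat.floor_le ?_)
    exact (Nat.cast_nonneg _).trans (hle ⟨0, hn⟩)
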